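/- **Notation.** For an $n$-mode system all matrices are complex and act on doubled-up vectors $(\mathbf a^T,(\mathbf a^{\#})^T)^T$. A matrix is doubled-up if it has the form $\Delta(X,Y)=\begin{pmatrix}X&Y\\Y^{\#}&X^{\#}\end{pmatrix}$, where $^{\#}$ is entrywise complex conjugation. Let $J_n=\mathrm{diag}(\mathbb 1_n,-\mathbb 1_n)$ and, for a $2m\times 2n$ matrix $X$, $X^\flat=J_nX^\dagger J_m$. A doubled-up $T$ is symplectic if $T^\flat T=TT^\flat=\mathbb 1$. A quantum linear system (QLS) with $m$ channels and $n\ge 0$ modes is a triple $(S,C,\Omega)$ with $S$ symplectic ($2m\times2m$), $C$ doubled-up ($2m\times 2n$) and $\Omega$ doubled-up and Hermitian ($2n\times2n$); $(C,\Omega)$ stands for $(\mathbb 1,C,\Omega)$, and SISO means $m=1$. Put $A=-\tfrac12C^\flat C-iJ_n\Omega$ and $\Xi(s)=\bigl(\mathbb 1-C(s\mathbb 1-A)^{-1}C^\flat\bigr)S$. The system is Hurwitz stable if all eigenvalues of $A$ have negative real part. For an input covariance $V=V(N,M)=\begin{pmatrix}N^T+\mathbb 1&M\\M^\dagger&N\end{pmatrix}$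 with $N=N^\dagger$, $M=M^T$, the power spectrum is $\Psi_V(s)=\Xi(s)V\,\Xi(-s^{\#})^\dagger$. For stable systems $\Xi$ and $\Psi_V$ are determined by, and identified with, their values on the imaginary axis $s=-i\omega$, $\omega\in\mathbb R$. The input is pure if $S_{\rm in}VS_{\rm in}^\dagger=V(0,0)$ for some symplectic $S_{\rm in}$. A stable QLS is globally minimal for $V$ if no stable QLS with fewer modes has the same power spectrum. **Corollary (indirect globally minimal realisation).** Let $V=V(N,M)$ be a pure input covariance for one channel. There is a map $\Psi\mapsto\Xi'_\Psi$ from power spectra to transfer functions such that, for every Hurwitz stable SISO QLS $(C,\Omega)$ with input $V$ and power spectrum $\Psi$, the following hold. 1. $\Xi'=\Xi'_\Psi$ is the transfer function of some globally minimal stable SISO QLS $(C',\Omega')$ with power spectrum $\Psi$ (a *globally minimal realisation* of $\Psi$). 2. $\Xi'$ has a minimal (observable and controllable) classical realisation $\Xi'(s)=\mathbb 1+C_0(s\mathbb 1-A_0)^{-1}B_0$ with doubled-up $A_0,B_0,C_0$. For every such realisation, with $2k\times2k$ matrix $A_0$, there is an invertible doubled-up $T$ with $$(T^\dagger J_kT)A_0+A_0^\dagger(T^\dagger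 J_kT)+C_0^\dagger J_1C_0=0,$$ and for every such $T$ the pair $$C'=C_0T^{-1},\qquad \Omega'=iJ_k\bigl(TA_0T^{-1}+\tfrac12C'^\flat C'\bigr)$$ is a SISO QLS with transfer function $\Xi'$ and is a globally minimal realisation of $\Psi$. 3. The globally minimal realisation is unique up to symplectic equivalence: if $(C_1,\Omega_1)$, with $k$ modes, is a globally minimal realisation of $\Psi$, then its transfer function is $\Xi'$, and a SISO QLS $(S_2,C_2,\Omega_2)$ with $l$ modes is a globally minimal realisation of $\Psi$ (in particular $S_2=\mathbb 1$) if and only if $S_2=\mathbb 1$, $l=k$ and there is a symplectic matrix $T$ with $J_k\Omega_2=TJ_k\Omega_1T^\flat$ and $C_2=C_1T^\flat$. -/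

import Mathlib

open scoped Matrix

noncomputable section

namespace QLin

/-- Index set of the doubled-up vectors `(a₁, …, aₙ, a₁^#, …, aₙ^#)`. -/
abbrev Doubled (n : ℕ) : Type := Fin n ⊕ Fin n

/-- Entrywise complex conjugation `X^#`. -/
def conjEntries {a b : Type*} (X : Matrix a b ℂ) : Matrix a b ℂ := X.map (starRingEnd ℂ)

/-- The doubled-up matrix `Δ(X, Y) = [X, Y; Y^#, X^#]`. -/
def Delta {a b : ℕ} (X Y : Matrix (Fin a) (Fin b) ℂ) : Matrix (Doubled a) (Doubled b) ℂ :=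
  Matrix.fromBlocks X Y (conjEntries Y) (conjEntries X)

def IsDoubledUp {a b : ℕ} (Z : Matrix (Doubled a) (Doubled b) ℂ) : Prop :=
  ∃ X Y : Matrix (Fin a) (Fin b) ℂ, Z = Delta X Y

/-- `Jₙ = diag(1ₙ, -1ₙ)`. -/
def J (n : ℕ) : Matrix (Doubled n) (Doubled n) ℂ := Matrix.fromBlocks 1 0 0 (-1)

/-- `X^♭ = J X† J`. -/
def flat {a b : ℕ} (X : Matrix (Doubled a) (Doubled b) ℂ) : Matrix (Doubled b) (Doubled a) ℂ :=
  J b * Xᴴ * J a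

/-- Symplectic matrices: `♭`-unitary and doubled-up. The two index sets are allowed to be
syntactically different; the two equations force `a = b`. -/
def IsSymplectic {a b : ℕ} (T : Matrix (Doubled a) (Doubled b) ℂ) : Prop :=
  IsDoubledUp T ∧ flat T * T = 1 ∧ T * flat T = 1

/-- Input covariance `V(N, M) = [Nᵀ + 1, M; M†, N]`. -/
def inputCovariance {m : ℕ} (N M : Matrix (Fin m) (Fin m) ℂ) :
    Matrix (Doubled m) (Doubled m) ℂ :=
  Matrix.fromBlocks (Nᵀ + 1) M Mᴴ N

/-- `V(N, M)` is the covariance of a pure Gaussian state: a symplectic change of the field modes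
turns it into the vacuum covariance `V(0, 0)` (so in particular `V(N, M) ≥ 0`; for one channel
this says `N ≥ 0` and `|M|² = N (N + 1)`). -/
def IsPureInput {m : ℕ} (N M : Matrix (Fin m) (Fin m) ℂ) : Prop :=
  N.IsHermitian ∧ M.IsSymm ∧
    ∃ T : Matrix (Doubled m) (Doubled m) ℂ, IsSymplectic T ∧
      T * inputCovariance N M * Tᴴ = inputCovariance 0 0

/-- All eigenvalues have strictly negative real part. -/
def IsHurwitzMatrix {n : ℕ} (A : Matrix (Doubled n) (Doubled n) ℂ) : Prop :=
  ∀ z ∈ spectrum ℂ A, z.re < 0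

/-- A quantum linear system with `m` channels and `n` modes, given by its scattering/squeezing
matrix, coupling matrix `C = Δ(C₋, C₊)` and hamiltonian matrix `Ω = Δ(Ω₋, Ω₊)`. That `Ω` is
Hermitian says `Ω₋ = Ω₋†` and `Ω₊ = Ω₊ᵀ`. -/
structure System (m n : ℕ) where
  S : Matrix (Doubled m) (Doubled m) ℂ
  C : Matrix (Doubled m) (Doubled n) ℂ
  Ω : Matrix (Doubled n) (Doubled n) ℂ
  symplectic_S : IsSymplectic S
  doubledUp_C : IsDoubledUp C
  doubledUp_Ω : IsDoubledUp Ω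
  hermitian_Ω : Ω.IsHermitian

namespace System

variable {m n : ℕ}

/-- `A = -½ C^♭ C - i Jₙ Ω`. -/
def A (G : System m n) : Matrix (Doubled n) (Doubled n) ℂ :=
  -((1 / 2 : ℂ) • (flat G.C * G.C)) - Complex.I • (J n * G.Ω)

def IsHurwitz (G : System m n) : Prop := IsHurwitzMatrix G.A

/-- `Ξ(s) = (1 - C (s - A)⁻¹ C^♭) S`. -/
def transfer (G : System m n) (s : ℂ) : Matrix (Doubled m) (Doubled m) ℂ :=
  (1 - G.C * (s • (1 : Matrix (Doubled n) (Doubled n) ℂ) - G.A)⁻¹ * flat G.C) * G.S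

/-- `Ψ_V(s) = Ξ(s) V Ξ(-s^#)†`. -/
def spectralDensity (G : System m n) (V : Matrix (Doubled m) (Doubled m) ℂ) (s : ℂ) :
    Matrix (Doubled m) (Doubled m) ℂ :=
  G.transfer s * V * (G.transfer (-(starRingEnd ℂ s)))ᴴ

/-- The transfer function in the frequency domain, `ω ↦ Ξ(-iω)`. A Hurwitz system has no pole on
the imaginary axis, and the rational function `Ξ` is determined by its values there. -/
def freqTransfer (G : System m n) : ℝ → Matrix (Doubled m) (Doubled m) ℂ :=
  fun ω => G.transfer (-(Complex.I * ω))

/-- The power spectrum in the frequency domain, `ω ↦ Ψ_V(-iω) = Ξ(-iω) V Ξ(-iω)†`. As for the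
transfer function, it determines the rational function `Ψ_V` of a Hurwitz system. -/
def powerSpectrum (G : System m n) (V : Matrix (Doubled m) (Doubled m) ℂ) :
    ℝ → Matrix (Doubled m) (Doubled m) ℂ :=
  fun ω => G.spectralDensity V (-(Complex.I * ω))

/-- No (stable) system with fewer modes has the same power spectrum. -/
def IsGloballyMinimal (G : System m n) (V : Matrix (Doubled m) (Doubled m) ℂ) : Prop :=
  G.IsHurwitz ∧ ∀ (k : ℕ) (K : System m k), K.IsHurwitz →
    K.powerSpectrum V = G.powerSpectrum V → n ≤ k

/-- `G = (1, C, Ω)` is a globally minimal realisation of the power spectrum `Ψ` for input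
covariance `V`. -/
def IsGloballyMinimalRealisation (G : System m n) (V : Matrix (Doubled m) (Doubled m) ℂ)
    (Ψ : ℝ → Matrix (Doubled m) (Doubled m) ℂ) : Prop :=
  G.S = 1 ∧ G.powerSpectrum V = Ψ ∧ G.IsGloballyMinimal V

/-- Symplectic equivalence: `J Ω' = T J Ω T^♭`, `C' = C T^♭`, `S = S'` for a symplectic `T`. -/
def SymplecticEquiv {n' : ℕ} (G : System m n) (G' : System m n') : Prop :=
  G.S = G'.S ∧ ∃ T : Matrix (Doubled n') (Doubled n) ℂ, IsSymplectic T ∧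
    J n' * G'.Ω = T * (J n * G.Ω) * flat T ∧ G'.C = G.C * flat T

end System

/-- `(A₀, B₀, C₀)` is a minimal (observable and controllable) classical linear system, with doubled-up
matrices and not necessarily physical, whose transfer function `1 + C₀ (s - A₀)⁻¹ B₀` is
`Ξ` on the imaginary axis `s = -iω`, away from the eigenvalues of `A₀`. -/
structure IsMinimalClassicalRealisation {m k : ℕ}
    (A₀ : Matrix (Doubled k) (Doubled k) ℂ) (B₀ : Matrix (Doubled k) (Doubled m) ℂ)
    (C₀ : Matrix (Doubled m) (Doubled k) ℂ) (Ξ : ℝ → Matrix (Doubled m) (Doubled m) ℂ) :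
    Prop where
  doubledUp_A : IsDoubledUp A₀
  doubledUp_B : IsDoubledUp B₀
  doubledUp_C : IsDoubledUp C₀
  observable : ∀ x : Doubled k → ℂ, (∀ j : ℕ, (C₀ * A₀ ^ j) *ᵥ x = 0) → x = 0
  controllable : ∀ x : Doubled k → ℂ, (∀ j : ℕ, x ᵥ* (A₀ ^ j * B₀) = 0) → x = 0
  transfer_eq : ∀ ω : ℝ, -(Complex.I * ω) ∉ spectrum ℂ A₀ →
    Ξ ω = 1 + C₀ * ((-(Complex.I * ω)) • (1 : Matrix (Doubled k) (Doubled k) ℂ) - A₀)⁻¹ * B₀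

/-- `T` is an invertible doubled-up solution of
`(T† J T) A₀ + A₀† (T† J T) + C₀† J C₀ = 0`. -/
def IsPhysicalTransformation {m k : ℕ} (A₀ : Matrix (Doubled k) (Doubled k) ℂ)
    (C₀ : Matrix (Doubled m) (Doubled k) ℂ) (T : Matrix (Doubled k) (Doubled k) ℂ) : Prop :=
  IsDoubledUp T ∧ IsUnit T ∧
    (Tᴴ * J k * T) * A₀ + A₀ᴴ * (Tᴴ * J k * T) + C₀ᴴ * J m * C₀ = 0

end QLin

end

/-! Write `V = v v†`: a pure one-channel input is the image of the vacuum, so its covariance has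
rank one and `v† J v = 1`. The spectrum is then `w w†` on the imaginary axis with `w(s) = Ξ(s) v`,
and determines `w` up to a phase depending on the frequency. The question is why global minimality
fixes this phase.

Two reductions shrink a stable system without changing its spectrum. Unobservable modes form an
isotropic subspace `N`, by uniqueness for the Lyapunov equation, and passing to `N^⊥ / N` preserves
the transfer function (`exists_smaller_of_unobs`). A zero `z` of `w` in the open right half-plane
yields an eigenvector of `A^♭`; splitting off this vector and its conjugate removes one mode and
multiplies `w` by the all-pass factor `(s + z^#) / (s - z)` (`exists_smaller_of_zero`). Both are
instances of `exists_reduction`, which rests on symplectic Gram-Schmidt.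

In a globally minimal realisation `w` is therefore holomorphic and zero-free in the right
half-plane, and tends to `v` at infinity. For two such vectors with equal spectra, the ratio and its
inverse are unimodular on the axis and tend to one, so Phragmen-Lindelöf and the maximum principle
make the ratio one (`eq_of_vecMulVec_eq`). The doubled-up symmetry converts knowledge of `Ξ(s) v`
into knowledge of `Ξ(s)` on the conjugate of `v`. For one channel these two vectors form a basis, so
`Ξ` is determined by the spectrum.

Passing from `Ξ` back to systems is Kalman's theorem: minimal realisations with equal Markov
parameters are similar, and the similarity inherits the doubled-up form. The Lyapunov equation of a
Hurwitz matrix has at most one solution, so two transformations solving it have the same `T† J T`;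
they differ by a symplectic matrix. -/

noncomputable section

namespace QLin

/-! ### Doubled-up matrices as fixed points of a conjugation -/

/-- The conjugation `x ↦ (x₂^#, x₁^#)` on doubled-up vectors. -/
def vconj {α : Type*} (x : α ⊕ α → ℂ) : α ⊕ α → ℂ := fun i => star (x i.swap)

/-- The conjugation on matrices whose fixed points are the doubled-up matrices. -/
def bar {α β : Type*} (Z : Matrix (α ⊕ α) (β ⊕ β) ℂ) : Matrix (α ⊕ α) (β ⊕ β) ℂ :=
  fun i j => star (Z i.swap j.swap)

section Bar

variable {α β γ : Type*}

@[simp] lemma vconj_vconj (x : α ⊕ α → ℂ) : vconj (vconj x) = x := by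
  ext i; simp [vconj]

@[simp] lemma vconj_zero : vconj (0 : α ⊕ α → ℂ) = 0 := by
  ext i; simp [vconj]

lemma vconj_smul (c : ℂ) (x : α ⊕ α → ℂ) : vconj (c • x) = star c • vconj x := by
  ext i; simp [vconj]

@[simp] lemma bar_bar (Z : Matrix (α ⊕ α) (β ⊕ β) ℂ) : bar (bar Z) = Z := by
  ext i j; simp [bar]

lemma bar_add (Y Z : Matrix (α ⊕ α) (β ⊕ β) ℂ) : bar (Y + Z) = bar Y + bar Z := by
  ext i j; simp [bar]

lemma bar_sub (Y Z : Matrix (α ⊕ α) (β ⊕ β) ℂ) : bar (Y - Z) = bar Y - bar Z := by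
  ext i j; simp [bar]

lemma bar_neg (Z : Matrix (α ⊕ α) (β ⊕ β) ℂ) : bar (-Z) = -bar Z := by
  ext i j; simp [bar]

@[simp] lemma bar_zero : bar (0 : Matrix (α ⊕ α) (β ⊕ β) ℂ) = 0 := by
  ext i j; simp [bar]

lemma bar_smul (c : ℂ) (Z : Matrix (α ⊕ α) (β ⊕ β) ℂ) : bar (c • Z) = star c • bar Z := by
  ext i j; simp [bar]

lemma bar_conjTranspose (Z : Matrix (α ⊕ α) (β ⊕ β) ℂ) : bar Zᴴ = (bar Z)ᴴ := by
  ext i j; simp [bar]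

@[simp] lemma bar_one [DecidableEq α] : bar (1 : Matrix (α ⊕ α) (α ⊕ α) ℂ) = 1 := by
  ext i j
  rcases i with i | i <;> rcases j with j | j <;> simp [bar, Matrix.one_apply]

lemma bar_mul [Fintype β] (Y : Matrix (α ⊕ α) (β ⊕ β) ℂ) (Z : Matrix (β ⊕ β) (γ ⊕ γ) ℂ) :
    bar (Y * Z) = bar Y * bar Z := by
  ext i j
  simp only [bar, Matrix.mul_apply, star_sum, star_mul']
  exact (Equiv.sumComm β β).sum_comp (fun k => star (Y i.swap k) * star (Z k j.swap)) |>.symm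

lemma vconj_mulVec [Fintype β] (Y : Matrix (α ⊕ α) (β ⊕ β) ℂ) (x : β ⊕ β → ℂ) :
    vconj (Y *ᵥ x) = bar Y *ᵥ vconj x := by
  ext i
  simp only [vconj, bar, Matrix.mulVec, dotProduct, star_sum, star_mul']
  exact (Equiv.sumComm β β).sum_comp (fun k => star (Y i.swap k) * star (x k)) |>.symm

lemma bar_pow [Fintype α] [DecidableEq α] (Z : Matrix (α ⊕ α) (α ⊕ α) ℂ) (j : ℕ) :
    bar (Z ^ j) = bar Z ^ j := by
  induction j with
  | zero => simp
  | succ j ih => rw [pow_succ, pow_succ, bar_mul, ih]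

lemma bar_inv [Fintype α] [DecidableEq α] (Z : Matrix (α ⊕ α) (α ⊕ α) ℂ) :
    bar Z⁻¹ = (bar Z)⁻¹ := by
  by_cases h : IsUnit Z.det
  · refine (Matrix.inv_eq_left_inv ?_).symm
    rw [← bar_mul, Matrix.nonsing_inv_mul _ h, bar_one]
  · have h' : ¬ IsUnit (bar Z).det := by
      intro h'
      apply h
      rw [← Matrix.isUnit_iff_isUnit_det]
      refine IsUnit.of_mul_eq_one (bar (bar Z)⁻¹) ?_
      rw [← bar_bar Z, bar_bar (bar Z), ← bar_mul, Matrix.mul_nonsing_inv _ h', bar_one]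
    rw [Matrix.nonsing_inv_apply_not_isUnit _ h, Matrix.nonsing_inv_apply_not_isUnit _ h', bar_zero]

end Bar

/-- As `bar` is multiplicative and antilinear, this form makes closure under products, powers,
inverses and adjoints a matter of rewriting. -/
lemma isDoubledUp_iff {a b : ℕ} {Z : Matrix (Doubled a) (Doubled b) ℂ} :
    IsDoubledUp Z ↔ bar Z = Z := by
  constructor
  · rintro ⟨X, Y, rfl⟩
    ext i j
    rcases i with i | i <;> rcases j with j | j <;> simp [bar, Delta, conjEntries]
  · intro h
    refine ⟨Z.toBlocks₁₁, Z.toBlocks₁₂, ?_⟩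
    ext i j
    rcases i with i | i <;> rcases j with j | j <;>
      simp only [Delta, conjEntries, Matrix.fromBlocks_apply₁₁, Matrix.fromBlocks_apply₁₂,
        Matrix.fromBlocks_apply₂₁, Matrix.fromBlocks_apply₂₂, Matrix.toBlocks₁₁, Matrix.toBlocks₁₂,
        Matrix.map_apply, Matrix.of_apply]
    · exact (congrFun (congrFun h (.inr i)) (.inl j)).symm
    · exact (congrFun (congrFun h (.inr i)) (.inr j)).symm

/-! ### The `♭`-adjoint -/

section Flat

variable {a b c : ℕ}

@[simp] lemma J_mul_J (n : ℕ) : J n * J n = 1 := by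
  simp [J, Matrix.fromBlocks_multiply]

@[simp] lemma conjTranspose_J (n : ℕ) : (J n)ᴴ = J n := by
  simp [J, Matrix.fromBlocks_conjTranspose]

/-- The conjugation exchanges the two blocks of `J`. The sign cancels in `X^♭`, where `J` occurs
twice, but reverses the form `x† J y`. -/
lemma bar_J (n : ℕ) : bar (J n) = -J n := by
  ext i j
  rcases i with i | i <;> rcases j with j | j <;>
    simp [bar, J, Matrix.one_apply]

lemma J_mul_cancel (X : Matrix (Doubled a) (Doubled b) ℂ) : J a * (J a * X) = X := by
  rw [← Matrix.mul_assoc, J_mul_J, Matrix.one_mul]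

lemma mul_J_cancel (X : Matrix (Doubled a) (Doubled b) ℂ) : X * J b * J b = X := by
  rw [Matrix.mul_assoc, J_mul_J, Matrix.mul_one]

@[simp] lemma flat_flat (X : Matrix (Doubled a) (Doubled b) ℂ) : flat (flat X) = X := by
  simp only [flat, Matrix.conjTranspose_mul, Matrix.conjTranspose_conjTranspose, conjTranspose_J]
  rw [J_mul_cancel, mul_J_cancel]

lemma flat_mul (X : Matrix (Doubled a) (Doubled b) ℂ) (Y : Matrix (Doubled b) (Doubled c) ℂ) :
    flat (X * Y) = flat Y * flat X := by
  simp only [flat, Matrix.conjTranspose_mul, Matrix.mul_assoc, J_mul_cancel]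

lemma flat_add (X Y : Matrix (Doubled a) (Doubled b) ℂ) : flat (X + Y) = flat X + flat Y := by
  simp only [flat, Matrix.conjTranspose_add, Matrix.mul_add, Matrix.add_mul]

lemma flat_neg (X : Matrix (Doubled a) (Doubled b) ℂ) : flat (-X) = -flat X := by
  simp only [flat, Matrix.conjTranspose_neg, Matrix.mul_neg, Matrix.neg_mul]

lemma flat_sub (X Y : Matrix (Doubled a) (Doubled b) ℂ) : flat (X - Y) = flat X - flat Y := by
  rw [sub_eq_add_neg, flat_add, flat_neg, sub_eq_add_neg]

lemma flat_smul (z : ℂ) (X : Matrix (Doubled a) (Doubled b) ℂ) :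
    flat (z • X) = star z • flat X := by
  simp only [flat, Matrix.conjTranspose_smul, Matrix.mul_smul, Matrix.smul_mul]

@[simp] lemma flat_one : flat (1 : Matrix (Doubled a) (Doubled a) ℂ) = 1 := by
  simp [flat]

@[simp] lemma flat_J : flat (J a) = J a := by
  simp [flat]

lemma bar_flat (X : Matrix (Doubled a) (Doubled b) ℂ) : bar (flat X) = flat (bar X) := by
  simp [flat, bar_mul, bar_J, bar_conjTranspose]

lemma IsDoubledUp.flat {X : Matrix (Doubled a) (Doubled b) ℂ} (h : IsDoubledUp X) :
    IsDoubledUp (flat X) := by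
  rw [isDoubledUp_iff] at *
  rw [bar_flat, h]

lemma IsDoubledUp.mul {X : Matrix (Doubled a) (Doubled b) ℂ}
    {Y : Matrix (Doubled b) (Doubled c) ℂ} (hX : IsDoubledUp X) (hY : IsDoubledUp Y) :
    IsDoubledUp (X * Y) := by
  rw [isDoubledUp_iff] at *
  rw [bar_mul, hX, hY]

lemma IsDoubledUp.inv {X : Matrix (Doubled a) (Doubled a) ℂ} (hX : IsDoubledUp X) :
    IsDoubledUp X⁻¹ := by
  rw [isDoubledUp_iff] at *
  rw [bar_inv, hX]

lemma IsDoubledUp.neg {X : Matrix (Doubled a) (Doubled b) ℂ} (hX : IsDoubledUp X) :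
    IsDoubledUp (-X) := by
  rw [isDoubledUp_iff] at *
  rw [bar_neg, hX]

lemma isDoubledUp_one : IsDoubledUp (1 : Matrix (Doubled a) (Doubled a) ℂ) := by
  rw [isDoubledUp_iff, bar_one]

lemma isSymplectic_one : IsSymplectic (1 : Matrix (Doubled a) (Doubled a) ℂ) :=
  ⟨isDoubledUp_one, by simp, by simp⟩

end Flat

/-! ### The indefinite form and its behaviour under conjugation -/

section Form

variable {a b n : ℕ}

/-- The indefinite inner product `x† J y`. -/
def br (x y : Doubled n → ℂ) : ℂ := star x ⬝ᵥ (J n *ᵥ y)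

lemma br_apply (x y : Doubled n → ℂ) :
    br x y = (∑ i, star (x (.inl i)) * y (.inl i)) - ∑ i, star (x (.inr i)) * y (.inr i) := by
  simp [br, J, dotProduct, Matrix.fromBlocks_mulVec, Fintype.sum_sum_type, Matrix.neg_mulVec,
    sub_eq_add_neg]

lemma br_add_right (x y z : Doubled n → ℂ) : br x (y + z) = br x y + br x z := by
  simp [br, Matrix.mulVec_add]

lemma br_sub_right (x y z : Doubled n → ℂ) : br x (y - z) = br x y - br x z := by
  simp [br, Matrix.mulVec_sub]

lemma br_smul_right (c : ℂ) (x y : Doubled n → ℂ) : br x (c • y) = c * br x y := by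
  simp [br, Matrix.mulVec_smul]

@[simp] lemma br_zero_right (x : Doubled n → ℂ) : br x 0 = 0 := by
  simp [br]

lemma br_neg_right (x y : Doubled n → ℂ) : br x (-y) = -br x y := by
  simp [br, Matrix.mulVec_neg]

lemma star_br (x y : Doubled n → ℂ) : star (br x y) = br y x := by
  simp [br_apply, mul_comm]

lemma br_eq_zero_symm {x y : Doubled n → ℂ} (h : br x y = 0) : br y x = 0 := by
  rw [← star_br, h, star_zero]

lemma br_add_left (x y z : Doubled n → ℂ) : br (x + y) z = br x z + br y z := by
  simp [br, add_dotProduct]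

lemma br_sub_left (x y z : Doubled n → ℂ) : br (x - y) z = br x z - br y z := by
  simp [br, sub_dotProduct]

lemma br_smul_left (c : ℂ) (x y : Doubled n → ℂ) : br (c • x) y = star c * br x y := by
  simp [br]

lemma br_neg_left (x y : Doubled n → ℂ) : br (-x) y = -br x y := by
  simp [br]

@[simp] lemma br_zero_left (y : Doubled n → ℂ) : br 0 y = 0 := by
  simp [br]

@[simp] lemma br_vconj_self (x : Doubled n → ℂ) : br x (vconj x) = 0 := by
  simp [br_apply, vconj, mul_comm]

/-- Because of this sign, a conjugation-invariant subspace has a vector of positive square as soon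
as it has one of nonzero square. -/
lemma br_vconj_vconj (x y : Doubled n → ℂ) : br (vconj x) (vconj y) = -star (br x y) := by
  simp [br_apply, vconj]

lemma br_vconj_left (x y : Doubled n → ℂ) : br (vconj x) y = -star (br x (vconj y)) := by
  rw [← br_vconj_vconj, vconj_vconj]

lemma br_mulVec (Z : Matrix (Doubled a) (Doubled b) ℂ) (x : Doubled a → ℂ) (y : Doubled b → ℂ) :
    br x (Z *ᵥ y) = br (flat Z *ᵥ x) y := by
  simp only [br, flat, Matrix.mulVec_mulVec, Matrix.star_mulVec, Matrix.conjTranspose_mul,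
    Matrix.conjTranspose_conjTranspose, conjTranspose_J, Matrix.dotProduct_mulVec,
    Matrix.vecMul_vecMul]
  rw [← Matrix.mul_assoc, mul_J_cancel]

lemma br_mulVec' (Z : Matrix (Doubled a) (Doubled b) ℂ) (x : Doubled a → ℂ) (y : Doubled b → ℂ) :
    br (Z *ᵥ y) x = br y (flat Z *ᵥ x) := by
  rw [br_mulVec, flat_flat]

open scoped ComplexOrder in
lemma eq_zero_of_br_eq_zero {y : Doubled n → ℂ} (h : ∀ x, br x y = 0) : y = 0 := by
  have h1 : J n *ᵥ y = 0 := by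
    rw [← dotProduct_star_self_eq_zero]
    exact h (J n *ᵥ y)
  rw [← Matrix.one_mulVec y, ← J_mul_J, ← Matrix.mulVec_mulVec, h1, Matrix.mulVec_zero]

end Form

/-! ### Physical realisability -/

namespace System

variable {m n : ℕ}

/-- Since `Ω` is Hermitian, `J Ω` is `♭`-self-adjoint and `i J Ω` cancels against its `♭`-adjoint;
only the coupling term survives. -/
lemma A_add_flat_A (G : System m n) : G.A + flat G.A + flat G.C * G.C = 0 := by
  have h : flat (J n * G.Ω) = J n * G.Ω := by
    rw [flat_mul, flat_J, flat, G.hermitian_Ω.eq, mul_J_cancel]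
  rw [A, flat_sub, flat_neg, flat_smul, flat_smul, flat_mul, h, flat_flat]
  have h1 : star (1 / 2 : ℂ) = 1 / 2 := by simp
  have h2 : star Complex.I = -Complex.I := by simp
  rw [h1, h2]
  module

lemma flat_A (G : System m n) : flat G.A = -G.A - flat G.C * G.C := by
  have := G.A_add_flat_A
  rw [← sub_eq_zero, ← this]
  abel

lemma isDoubledUp_A (G : System m n) : IsDoubledUp G.A := by
  have hC := isDoubledUp_iff.1 G.doubledUp_C
  have hΩ := isDoubledUp_iff.1 G.doubledUp_Ω
  rw [isDoubledUp_iff, A, bar_sub, bar_neg, bar_smul, bar_smul, bar_mul, bar_mul, bar_flat, bar_J,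
    hC, hΩ]
  simp

/-- The system with `S = 1` determined by doubled-up matrices `A`, `C` satisfying the physical
realisability condition. -/
def ofAC (A : Matrix (Doubled n) (Doubled n) ℂ) (C : Matrix (Doubled m) (Doubled n) ℂ)
    (hA : IsDoubledUp A) (hC : IsDoubledUp C) (h : A + QLin.flat A + QLin.flat C * C = 0) :
    System m n where
  S := 1
  C := C
  Ω := Complex.I • (J n * (A + (1 / 2 : ℂ) • (QLin.flat C * C)))
  symplectic_S := isSymplectic_one
  doubledUp_C := hC
  doubledUp_Ω := by
    rw [isDoubledUp_iff] at *
    rw [bar_smul, bar_mul, bar_J, bar_add, bar_smul, bar_mul, bar_flat, hA, hC]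
    simp
  hermitian_Ω := by
    have h1 : A = -QLin.flat A - QLin.flat C * C := by
      rw [← sub_eq_zero, ← h]; abel
    have h2 : ∀ X : Matrix (Doubled n) (Doubled n) ℂ, (J n * X)ᴴ = J n * QLin.flat X := by
      intro X
      rw [QLin.flat, Matrix.mul_assoc, J_mul_cancel, Matrix.conjTranspose_mul, conjTranspose_J]
    rw [Matrix.IsHermitian, Matrix.conjTranspose_smul, h2, flat_add, flat_smul, flat_mul, flat_flat]
    have h1' : star (1 / 2 : ℂ) = 1 / 2 := by simp
    have h2' : star Complex.I = -Complex.I := by simp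
    rw [h1', h2', neg_smul, ← smul_neg, ← Matrix.mul_neg]
    congr 2
    nth_rewrite 2 [h1]
    module

@[simp] lemma ofAC_A (A : Matrix (Doubled n) (Doubled n) ℂ) (C : Matrix (Doubled m) (Doubled n) ℂ)
    (hA hC h) : (ofAC A C hA hC h).A = A := by
  simp only [System.A, ofAC, Matrix.mul_smul, smul_smul, J_mul_cancel, Complex.I_mul_I]
  module

@[simp] lemma ofAC_C (A : Matrix (Doubled n) (Doubled n) ℂ) (C : Matrix (Doubled m) (Doubled n) ℂ)
    (hA hC h) : (ofAC A C hA hC h).C = C := rfl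

end System

/-! ### Symplectic Gram-Schmidt -/

section Darboux

variable {n d : ℕ}

/-- The doubled-up matrix with columns `p₁, …, p_d` and their conjugates. -/
def dcols (p : Fin d → Doubled n → ℂ) : Matrix (Doubled n) (Doubled d) ℂ :=
  fun i j => Sum.elim p (fun k => vconj (p k)) j i

lemma isDoubledUp_dcols (p : Fin d → Doubled n → ℂ) : IsDoubledUp (dcols p) := by
  rw [isDoubledUp_iff]
  ext i j
  rcases j with j | j <;> simp [bar, dcols, vconj]

lemma dcols_mulVec (p : Fin d → Doubled n → ℂ) (y : Doubled d → ℂ) :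
    dcols p *ᵥ y = ∑ k, (y (.inl k) • p k + y (.inr k) • vconj (p k)) := by
  ext i
  simp [dcols, Matrix.mulVec, dotProduct, Fintype.sum_sum_type, Finset.sum_add_distrib, mul_comm]

/-- A family of vectors spanning, with their conjugates, a symplectic subspace. -/
structure SymplecticFamily (p : Fin d → Doubled n → ℂ) : Prop where
  br_eq : ∀ i j, br (p i) (p j) = if i = j then 1 else 0
  br_vconj_eq : ∀ i j, br (p i) (vconj (p j)) = 0

lemma flat_mul_apply {a b c : ℕ} (X : Matrix (Doubled a) (Doubled b) ℂ)
    (Y : Matrix (Doubled a) (Doubled c) ℂ) (i : Doubled b) (j : Doubled c) :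
    (flat X * Y) i j = J b i i * br (fun k => X k i) (fun k => Y k j) := by
  have h : ∀ Z : Matrix (Doubled b) (Doubled c) ℂ, (J b * Z) i j = J b i i * Z i j := by
    intro Z
    rcases i with i | i <;>
      simp [J, Matrix.mul_apply, Matrix.one_apply, Matrix.fromBlocks, Fintype.sum_sum_type]
  rw [flat, Matrix.mul_assoc, Matrix.mul_assoc, h]
  rfl

lemma SymplecticFamily.flat_mul_self {p : Fin d → Doubled n → ℂ} (hp : SymplecticFamily p) :
    flat (dcols p) * dcols p = 1 := by
  ext i j
  rw [flat_mul_apply]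
  rcases i with i | i <;> rcases j with j | j
  · simp [dcols, J, hp.br_eq, Matrix.one_apply]
  · simp [dcols, J, hp.br_vconj_eq]
  · simp [dcols, J, br_vconj_left, hp.br_vconj_eq]
  · have := br_vconj_vconj (p i) (p j)
    simp only [dcols, J, Sum.elim_inr, this, hp.br_eq]
    by_cases h : i = j <;> simp [h, Matrix.one_apply]

lemma le_of_flat_mul_self {P : Matrix (Doubled n) (Doubled d) ℂ} (h : flat P * P = 1) : d ≤ n := by
  have hinj : Function.Injective (Matrix.mulVecLin P) := by
    intro x y hxy
    have := congrArg (fun z => flat P *ᵥ z) hxy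
    simpa [Matrix.mulVec_mulVec, h] using this
  have := LinearMap.finrank_le_finrank_of_injective hinj
  simp at this
  omega

lemma lt_of_notMem_range {P : Matrix (Doubled n) (Doubled d) ℂ} (h : flat P * P = 1)
    {x : Doubled n → ℂ} (hx : ∀ y, P *ᵥ y ≠ x) : d < n := by
  refine lt_of_le_of_ne (le_of_flat_mul_self h) ?_
  rintro rfl
  have h' := mul_eq_one_comm.1 h
  exact hx (flat P *ᵥ x) (by rw [Matrix.mulVec_mulVec, h', Matrix.one_mulVec])

lemma br_self_real (x : Doubled n → ℂ) : ((br x x).re : ℂ) = br x x :=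
  Complex.conj_eq_iff_re.1 (star_br x x)

/-- A subspace on which the form is not identically zero contains a vector of nonzero square. -/
lemma exists_br_self_ne_zero {U : Submodule ℂ (Doubled n → ℂ)} {x y : Doubled n → ℂ} (hx : x ∈ U)
    (hy : y ∈ U) (hxy : br x y ≠ 0) : ∃ w ∈ U, br w w ≠ 0 := by
  by_contra! h
  have h1 := h _ (U.add_mem hx hy)
  have h2 := h _ (U.add_mem hx (U.smul_mem Complex.I hy))
  have hI : star Complex.I = -Complex.I := by simp
  -- Polarisation: the squares of `x + y` and `x + i y` give the real and the imaginary part of `x†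
  -- J y`.
  simp only [br_add_left, br_add_right, br_smul_left, br_smul_right, h x hx, h y hy, hI] at h1 h2
  apply hxy
  have h3 : Complex.I * (br x y - br y x) = 0 := by linear_combination h2
  have h4 : br x y - br y x = 0 := by simpa using h3
  linear_combination (1 / 2) * h1 + (1 / 2) * h4

/-- Inside a conjugation-invariant subspace on which the form is nonzero, one finds a vector of
square one. -/
lemma exists_br_self_eq_one {U : Submodule ℂ (Doubled n → ℂ)} (hU : ∀ x ∈ U, vconj x ∈ U)
    {x y : Doubled n → ℂ} (hx : x ∈ U) (hy : y ∈ U) (hxy : br x y ≠ 0) :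
    ∃ w ∈ U, br w w = 1 := by
  have key : ∃ w ∈ U, 0 < (br w w).re := by
    obtain ⟨w, hw, hw0⟩ := exists_br_self_ne_zero hx hy hxy
    have hne : (br w w).re ≠ 0 := fun h => hw0 (by rw [← br_self_real, h, Complex.ofReal_zero])
    rcases lt_or_gt_of_ne hne with h | h
    · refine ⟨vconj w, hU w hw, ?_⟩
      rw [br_vconj_vconj]
      simpa using h
    · exact ⟨w, hw, h⟩
  obtain ⟨w, hw, hpos⟩ := key
  refine ⟨((Real.sqrt (br w w).re : ℝ) : ℂ)⁻¹ • w, U.smul_mem _ hw, ?_⟩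
  rw [br_smul_left, br_smul_right, ← br_self_real w]
  generalize (br w w).re = r at hpos
  have h2 : ((Real.sqrt r : ℝ) : ℂ) ≠ 0 := by exact_mod_cast (Real.sqrt_pos.2 hpos).ne'
  have h3 : (r : ℂ) = ((Real.sqrt r : ℝ) : ℂ) * (Real.sqrt r : ℝ) := by
    rw [← Complex.ofReal_mul, Real.mul_self_sqrt hpos.le]
  have h4 : star (((Real.sqrt r : ℝ) : ℂ)⁻¹) = ((Real.sqrt r : ℝ) : ℂ)⁻¹ := by simp
  rw [h3, h4]
  field_simp

lemma SymplecticFamily.snoc {p : Fin d → Doubled n → ℂ} (hp : SymplecticFamily p)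
    {w : Doubled n → ℂ} (hw : br w w = 1) (h1 : ∀ k, br (p k) w = 0)
    (h2 : ∀ k, br (p k) (vconj w) = 0) :
    SymplecticFamily (Fin.snoc p w : Fin (d + 1) → Doubled n → ℂ) := by
  have h1' : ∀ k, br w (p k) = 0 := fun k => br_eq_zero_symm (h1 k)
  have h2' : ∀ k, br w (vconj (p k)) = 0 := by
    intro k
    have := br_vconj_left w (p k)
    rw [br_eq_zero_symm (h2 k), eq_comm, neg_eq_zero, star_eq_zero] at this
    exact this
  constructor
  · intro i j
    refine Fin.lastCases ?_ (fun i => ?_) i <;> refine Fin.lastCases ?_ (fun j => ?_) j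
    · simp [hw]
    · simp [h1', (Fin.castSucc_lt_last j).ne']
    · simp [h1, (Fin.castSucc_lt_last i).ne]
    · simp [hp.br_eq]
  · intro i j
    refine Fin.lastCases ?_ (fun i => ?_) i <;> refine Fin.lastCases ?_ (fun j => ?_) j
    · simp
    · simp [h2']
    · simp [h2]
    · simp [hp.br_vconj_eq]

/-- Symplectic Gram-Schmidt: a conjugation-invariant subspace is, modulo its radical, the range of a
doubled-up isometry. -/
theorem exists_isometry (U : Submodule ℂ (Doubled n → ℂ)) (hU : ∀ x ∈ U, vconj x ∈ U) :
    ∃ (d : ℕ) (P : Matrix (Doubled n) (Doubled d) ℂ), IsDoubledUp P ∧ flat P * P = 1 ∧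
      (∀ y, P *ᵥ y ∈ U) ∧
      ∀ x ∈ U, ∀ y ∈ U, br y (x - P *ᵥ (flat P *ᵥ x)) = 0 := by
  classical
  -- A symplectic family of maximal size is taken; the empty family starts the search and the
  -- dimension bounds it.
  let S : Set ℕ := {d | ∃ p : Fin d → Doubled n → ℂ, SymplecticFamily p ∧ ∀ k, p k ∈ U}
  have hS0 : (0 : ℕ) ∈ S := ⟨Fin.elim0, ⟨fun i => i.elim0, fun i => i.elim0⟩, fun i => i.elim0⟩
  have hSb : ∀ d ∈ S, d ≤ n := by
    rintro d ⟨p, hp, -⟩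
    exact le_of_flat_mul_self hp.flat_mul_self
  have hbdd : BddAbove S := ⟨n, hSb⟩
  obtain ⟨d, ⟨p, hp, hpU⟩, hmax⟩ : ∃ d ∈ S, ∀ d' ∈ S, d' ≤ d :=
    ⟨sSup S, Nat.sSup_mem ⟨0, hS0⟩ hbdd, fun _ h => le_csSup hbdd h⟩
  have hrange : ∀ y, dcols p *ᵥ y ∈ U := by
    intro y
    rw [dcols_mulVec]
    exact U.sum_mem fun k _ => U.add_mem (U.smul_mem _ (hpU k)) (U.smul_mem _ (hU _ (hpU k)))
  refine ⟨d, dcols p, isDoubledUp_dcols p, hp.flat_mul_self, hrange, ?_⟩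
  set P := dcols p with hP
  have hPP := hp.flat_mul_self
  -- The part of `U` orthogonal to the family. Were the form nonzero on it, a vector of square one
  -- would enlarge the family, against maximality.
  let Q : Submodule ℂ (Doubled n → ℂ) := U ⊓ LinearMap.ker (Matrix.mulVecLin (flat P))
  have hproj : ∀ x ∈ U, x - P *ᵥ (flat P *ᵥ x) ∈ Q := by
    intro x hx
    refine ⟨U.sub_mem hx (hrange _), ?_⟩
    simp only [SetLike.mem_coe, LinearMap.mem_ker, Matrix.mulVecLin_apply, Matrix.mulVec_sub,
      Matrix.mulVec_mulVec]
    rw [← Matrix.mul_assoc, hPP, Matrix.one_mul, sub_self]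
  have hQ : ∀ x ∈ Q, vconj x ∈ Q := by
    rintro x ⟨hx, hx'⟩
    refine ⟨hU x hx, ?_⟩
    simp only [SetLike.mem_coe, LinearMap.mem_ker, Matrix.mulVecLin_apply] at hx' ⊢
    have h := vconj_mulVec (flat P) x
    rw [bar_flat, isDoubledUp_iff.1 (isDoubledUp_dcols p), hx', vconj_zero] at h
    exact h.symm
  have hpcol : ∀ k, P *ᵥ Pi.single (.inl k) 1 = p k := by
    intro k
    ext i
    simp [hP, dcols]
  have hQp : ∀ x ∈ Q, ∀ k, br (p k) x = 0 := by
    rintro x ⟨-, hx⟩ k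
    simp only [SetLike.mem_coe, LinearMap.mem_ker, Matrix.mulVecLin_apply] at hx
    rw [← hpcol, br_mulVec', hx, br_zero_right]
  have hiso : ∀ x ∈ Q, ∀ y ∈ Q, br y x = 0 := by
    intro x hx y hy
    by_contra hne
    obtain ⟨w, hw, hw1⟩ := exists_br_self_eq_one hQ hy hx hne
    have hmem : d + 1 ∈ S := by
      refine ⟨Fin.snoc p w, hp.snoc hw1 (hQp w hw) (hQp _ (hQ w hw)), fun k => ?_⟩
      refine Fin.lastCases ?_ (fun k => ?_) k
      · simpa using hw.1
      · simpa using hpU k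
    have := hmax _ hmem
    omega
  intro x hx y hy
  have h1 : y = (y - P *ᵥ (flat P *ᵥ y)) + P *ᵥ (flat P *ᵥ y) := by abel
  have h2 := (hproj x hx).2
  simp only [SetLike.mem_coe, LinearMap.mem_ker, Matrix.mulVecLin_apply] at h2
  rw [h1, br_add_left, hiso _ (hproj x hx) _ (hproj y hy), br_mulVec', h2]
  simp

end Darboux

/-! ### Uniqueness for the Lyapunov equation -/

section Sylvester

open Polynomial

variable {n k : ℕ}

lemma mem_spectrum_iff_exists_mulVec {ι : Type*} [Fintype ι] [DecidableEq ι] {A : Matrix ι ι ℂ}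
    {z : ℂ} : z ∈ spectrum ℂ A ↔ ∃ x, x ≠ 0 ∧ A *ᵥ x = z • x := by
  rw [spectrum.mem_iff, Matrix.isUnit_iff_isUnit_det, isUnit_iff_ne_zero, not_not,
    ← Matrix.exists_mulVec_eq_zero_iff]
  refine exists_congr fun x => and_congr_right fun _ => ?_
  rw [Matrix.sub_mulVec, sub_eq_zero, eq_comm, Algebra.algebraMap_eq_smul_one, Matrix.smul_mulVec,
    Matrix.one_mulVec]

/-- If `A` is skew for the form `x† X y` on an invariant subspace, then a polynomial in `A` moves to
the other argument as its reflected conjugate. -/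
lemma star_dotProduct_aeval {X A : Matrix (Doubled n) (Doubled n) ℂ}
    {N : Submodule ℂ (Doubled n → ℂ)} (hN : ∀ x ∈ N, A *ᵥ x ∈ N)
    (h : ∀ x ∈ N, ∀ y ∈ N, star (A *ᵥ x) ⬝ᵥ (X *ᵥ y) + star x ⬝ᵥ (X *ᵥ (A *ᵥ y)) = 0)
    (p : ℂ[X]) {x : Doubled n → ℂ} (hx : x ∈ N) :
    aeval A p *ᵥ x ∈ N ∧ ∀ y ∈ N, star (aeval A p *ᵥ x) ⬝ᵥ (X *ᵥ y) =
      star x ⬝ᵥ (X *ᵥ (aeval A ((p.map (starRingEnd ℂ)).comp (-Polynomial.X)) *ᵥ y)) := by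
  induction p using Polynomial.induction_on' with
  | add p q hp hq =>
    refine ⟨?_, fun y hy => ?_⟩
    · rw [map_add, Matrix.add_mulVec]
      exact N.add_mem hp.1 hq.1
    · simp only [map_add, Matrix.add_mulVec, star_add, add_dotProduct, Polynomial.map_add,
        add_comp, Matrix.mulVec_add, dotProduct_add, hp.2 y hy, hq.2 y hy]
  | monomial j c =>
    have hpow : ∀ j : ℕ, ∀ x ∈ N, A ^ j *ᵥ x ∈ N := by
      intro j
      induction j with
      | zero => intro x hx; simpa using hx
      | succ j ih =>
        intro x hx
        rw [pow_succ, ← Matrix.mulVec_mulVec]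
        exact ih _ (hN x hx)
    have hj : ∀ j : ℕ, ∀ x ∈ N, ∀ y ∈ N, star (A ^ j *ᵥ x) ⬝ᵥ (X *ᵥ y) =
        star x ⬝ᵥ (X *ᵥ ((-A) ^ j *ᵥ y)) := by
      intro j
      induction j with
      | zero => intro x _ y _; simp
      | succ j ih =>
        intro x hx y hy
        have hm : (-A) ^ j *ᵥ y ∈ N := by
          rw [neg_pow]
          rcases neg_one_pow_eq_or (Matrix (Doubled n) (Doubled n) ℂ) j with e | e <;> rw [e]
          · simpa using hpow j y hy
          · simpa [Matrix.neg_mulVec] using hpow j y hy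
        rw [pow_succ, ← Matrix.mulVec_mulVec, ih _ (hN x hx) y hy, pow_succ', ← Matrix.mulVec_mulVec,
          Matrix.neg_mulVec, Matrix.mulVec_neg, dotProduct_neg]
        exact eq_neg_of_add_eq_zero_left (h x hx _ hm)
    refine ⟨?_, fun y hy => ?_⟩
    · rw [aeval_monomial, Algebra.algebraMap_eq_smul_one, smul_one_mul, Matrix.smul_mulVec]
      exact N.smul_mem _ (hpow j x hx)
    · rw [Polynomial.map_monomial, monomial_comp, map_mul, aeval_C, map_pow, map_neg, aeval_X,
        aeval_monomial, Algebra.algebraMap_eq_smul_one, Algebra.algebraMap_eq_smul_one, smul_one_mul,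
        smul_one_mul, Matrix.smul_mulVec, Matrix.smul_mulVec, star_smul, smul_dotProduct,
        Matrix.mulVec_smul, dotProduct_smul, hj j x hx y hy]
      rfl

/-- Uniqueness for the Lyapunov equation of a Hurwitz matrix, restricted to an invariant
subspace. -/
theorem lyapunov_unique {X A : Matrix (Doubled n) (Doubled n) ℂ} (hA : IsHurwitzMatrix A)
    {N : Submodule ℂ (Doubled n → ℂ)} (hN : ∀ x ∈ N, A *ᵥ x ∈ N)
    (h : ∀ x ∈ N, ∀ y ∈ N, star (A *ᵥ x) ⬝ᵥ (X *ᵥ y) + star x ⬝ᵥ (X *ᵥ (A *ᵥ y)) = 0)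
    {x y : Doubled n → ℂ} (hx : x ∈ N) (hy : y ∈ N) : star x ⬝ᵥ (X *ᵥ y) = 0 := by
  -- The roots of `q` are the reflections `-λ^#` of the eigenvalues, so they have positive real part
  -- and `q(A)` is invertible. The form at `(x, q(A) w)` equals the form at `(p(A) x, w)` for the
  -- characteristic polynomial `p`, which vanishes by Cayley-Hamilton.
  set q : ℂ[X] := (A.charpoly.map (starRingEnd ℂ)).comp (-Polynomial.X) with hq
  have hunit : Function.Injective (Matrix.mulVecLin (aeval A q)) := by
    rw [← LinearMap.ker_eq_bot, LinearMap.ker_eq_bot']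
    intro w hw
    by_contra hw0
    have h0 : (0 : ℂ) ∈ spectrum ℂ (aeval A q) :=
      mem_spectrum_iff_exists_mulVec.2 ⟨w, hw0, by simpa using hw⟩
    rw [spectrum.map_polynomial_aeval_of_nonempty A q
      (by
        have : Nonempty (Doubled n) := by
          by_contra hne
          rw [not_nonempty_iff] at hne
          exact hw0 (Subsingleton.elim _ _)
        exact spectrum.nonempty_of_isAlgClosed_of_finiteDimensional ℂ A)] at h0
    obtain ⟨z, hz, hz0⟩ := h0
    simp only [hq, eval_comp, eval_neg, eval_X] at hz0
    have hz1 : A.charpoly.eval (-(starRingEnd ℂ z)) = 0 := by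
      have e : -z = starRingEnd ℂ (-(starRingEnd ℂ z)) := by simp
      rw [e, Polynomial.eval_map, Polynomial.eval₂_at_apply] at hz0
      exact (map_eq_zero _).1 hz0
    have hz2 : -(starRingEnd ℂ z) ∈ spectrum ℂ A :=
      Matrix.mem_spectrum_iff_isRoot_charpoly.2 hz1
    have h1 := hA _ hz
    have h2 := hA _ hz2
    simp at h2
    linarith
  have hqN : ∀ w ∈ N, aeval A q *ᵥ w ∈ N := fun w hw => (star_dotProduct_aeval hN h q hw).1
  have hsurj : Function.Surjective ((Matrix.mulVecLin (aeval A q)).restrict hqN) :=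
    LinearMap.surjective_of_injective fun a b hab => by
      apply Subtype.ext
      apply hunit
      exact congrArg Subtype.val hab
  obtain ⟨w, hw⟩ := hsurj ⟨y, hy⟩
  have hw' : aeval A q *ᵥ w.1 = y := congrArg Subtype.val hw
  rw [← hw', ← (star_dotProduct_aeval hN h A.charpoly hx).2 w.1 w.2, Matrix.aeval_self_charpoly]
  simp

theorem lyapunov_unique_matrix {X A : Matrix (Doubled n) (Doubled n) ℂ} (hA : IsHurwitzMatrix A)
    (h : X * A + Aᴴ * X = 0) : X = 0 := by
  have key : ∀ x y, star x ⬝ᵥ (X *ᵥ y) = 0 := fun x y =>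
    lyapunov_unique (N := ⊤) hA (fun _ _ => trivial)
      (fun x _ y _ => by
        have := congrArg (fun Z => star x ⬝ᵥ (Z *ᵥ y)) h
        simp only [Matrix.add_mulVec, dotProduct_add, Matrix.zero_mulVec, dotProduct_zero] at this
        rw [Matrix.star_mulVec, ← Matrix.dotProduct_mulVec, Matrix.mulVec_mulVec,
          Matrix.mulVec_mulVec, add_comm]
        exact this)
      (x := x) (y := y) trivial trivial
  ext i j
  have := key (Pi.single i 1) (Pi.single j 1)
  simpa [← Pi.single_star] using this

end Sylvester

/-! ### Resolvents of Hurwitz matrices on invariant subspaces -/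

section Resolvent

variable {n : ℕ}

lemma IsHurwitzMatrix.isUnit_det {A : Matrix (Doubled n) (Doubled n) ℂ} (hA : IsHurwitzMatrix A)
    {s : ℂ} (hs : 0 ≤ s.re) :
    IsUnit (s • (1 : Matrix (Doubled n) (Doubled n) ℂ) - A).det := by
  rw [← Matrix.isUnit_iff_isUnit_det, ← Algebra.algebraMap_eq_smul_one]
  by_contra h
  exact absurd (hA s (spectrum.mem_iff.2 h)) (not_lt.2 hs)

lemma IsHurwitzMatrix.inv_mulVec_eq {A : Matrix (Doubled n) (Doubled n) ℂ} (hA : IsHurwitzMatrix A)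
    {s : ℂ} (hs : 0 ≤ s.re) {x y : Doubled n → ℂ} (h : s • x - A *ᵥ x = y) :
    (s • (1 : Matrix (Doubled n) (Doubled n) ℂ) - A)⁻¹ *ᵥ y = x := by
  have h1 : (s • (1 : Matrix (Doubled n) (Doubled n) ℂ) - A) *ᵥ x = y := by
    rw [Matrix.sub_mulVec, Matrix.smul_mulVec, Matrix.one_mulVec, h]
  rw [← h1, Matrix.mulVec_mulVec, Matrix.nonsing_inv_mul _ (hA.isUnit_det hs), Matrix.one_mulVec]

lemma IsHurwitzMatrix.inv_mulVec_sub {A : Matrix (Doubled n) (Doubled n) ℂ} (hA : IsHurwitzMatrix A)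
    {s : ℂ} (hs : 0 ≤ s.re) (y : Doubled n → ℂ) :
    s • ((s • (1 : Matrix (Doubled n) (Doubled n) ℂ) - A)⁻¹ *ᵥ y) -
      A *ᵥ ((s • (1 : Matrix (Doubled n) (Doubled n) ℂ) - A)⁻¹ *ᵥ y) = y := by
  rw [← Matrix.one_mulVec ((s • (1 : Matrix (Doubled n) (Doubled n) ℂ) - A)⁻¹ *ᵥ y),
    ← Matrix.smul_mulVec, Matrix.one_mulVec, ← Matrix.sub_mulVec, Matrix.mulVec_mulVec,
    Matrix.mul_nonsing_inv _ (hA.isUnit_det hs), Matrix.one_mulVec]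

/-- A subspace invariant under a Hurwitz matrix is invariant under its resolvent. -/
lemma IsHurwitzMatrix.inv_mulVec_mem {A : Matrix (Doubled n) (Doubled n) ℂ}
    (hA : IsHurwitzMatrix A) {N : Submodule ℂ (Doubled n → ℂ)} (hN : ∀ x ∈ N, A *ᵥ x ∈ N)
    {s : ℂ} (hs : 0 ≤ s.re) {y : Doubled n → ℂ} (hy : y ∈ N) :
    (s • (1 : Matrix (Doubled n) (Doubled n) ℂ) - A)⁻¹ *ᵥ y ∈ N := by
  set Z := s • (1 : Matrix (Doubled n) (Doubled n) ℂ) - A with hZ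
  have hZN : ∀ x ∈ N, Matrix.mulVecLin Z x ∈ N := by
    intro x hx
    rw [Matrix.mulVecLin_apply, hZ, Matrix.sub_mulVec, Matrix.smul_mulVec, Matrix.one_mulVec]
    exact N.sub_mem (N.smul_mem _ hx) (hN x hx)
  have hZZ : Z⁻¹ * Z = 1 := Matrix.nonsing_inv_mul _ (hA.isUnit_det hs)
  have hsurj : Function.Surjective ((Matrix.mulVecLin Z).restrict hZN) :=
    LinearMap.surjective_of_injective fun a b hab => by
      apply Subtype.ext
      have h := congrArg (fun w => Z⁻¹ *ᵥ w) (congrArg Subtype.val hab)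
      simp only [LinearMap.coe_restrict_apply, Matrix.mulVecLin_apply, Matrix.mulVec_mulVec, hZZ,
        Matrix.one_mulVec] at h
      exact h
  obtain ⟨w, hw⟩ := hsurj ⟨y, hy⟩
  have hw' : Z *ᵥ w.1 = y := congrArg Subtype.val hw
  rw [← hw', Matrix.mulVec_mulVec, hZZ, Matrix.one_mulVec]
  exact w.2

end Resolvent

/-! ### Compression of a system -/

section Reduction

variable {m n : ℕ}

/-- Compression of a system to an invariant subspace modulo a radical hidden from the output. -/
theorem System.exists_reduction (G : System m n) (hG : G.IsHurwitz)
    (U R : Submodule ℂ (Doubled n → ℂ)) (hU : ∀ x ∈ U, vconj x ∈ U) (hAU : ∀ x ∈ U, G.A *ᵥ x ∈ U)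
    (hR : ∀ x ∈ R, (∀ y ∈ U, br y x = 0) ∧ G.C *ᵥ x = 0 ∧ G.A *ᵥ x ∈ R)
    (hUR : ∀ x ∈ U, (∀ y ∈ U, br y x = 0) → x ∈ R)
    (hlt : ∃ x, x ∉ U ∨ (x ∈ R ∧ x ≠ 0)) :
    ∃ (d : ℕ) (P : Matrix (Doubled n) (Doubled d) ℂ) (K : System m d), d < n ∧
      flat P * P = 1 ∧ (∀ y, P *ᵥ y ∈ U) ∧ (∀ x ∈ U, x - P *ᵥ (flat P *ᵥ x) ∈ R) ∧
      K.IsHurwitz ∧ K.S = 1 ∧ K.C = G.C * P ∧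
      ∀ s : ℂ, 0 ≤ s.re → K.C * (s • (1 : Matrix (Doubled d) (Doubled d) ℂ) - K.A)⁻¹ =
        G.C * (s • (1 : Matrix (Doubled n) (Doubled n) ℂ) - G.A)⁻¹ * P := by
  obtain ⟨d, P, hPd, hPP, hPU, hPR⟩ := exists_isometry U hU
  have hproj : ∀ x ∈ U, x - P *ᵥ (flat P *ᵥ x) ∈ R := fun x hx =>
    hUR _ (U.sub_mem hx (hPU _)) fun y hy => hPR x hx y hy
  have hflatR : ∀ x ∈ R, flat P *ᵥ x = 0 := by
    intro x hx
    refine eq_zero_of_br_eq_zero fun y => ?_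
    rw [br_mulVec, flat_flat]
    exact (hR x hx).1 _ (hPU y)
  have hcancel : ∀ y, flat P *ᵥ (P *ᵥ y) = y := by
    intro y
    rw [Matrix.mulVec_mulVec, hPP, Matrix.one_mulVec]
  have hdn : d < n := by
    obtain ⟨x, hx⟩ := hlt
    refine lt_of_notMem_range hPP (x := x) ?_
    rintro y rfl
    rcases hx with hx | ⟨hx, hx0⟩
    · exact hx (hPU y)
    · apply hx0
      have := hcancel y
      rw [hflatR _ hx] at this
      rw [← this, Matrix.mulVec_zero]
  have hPdu := isDoubledUp_iff.1 hPd
  set Ar := flat P * G.A * P with hAr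
  have hArd : IsDoubledUp Ar := (hPd.flat.mul G.isDoubledUp_A).mul hPd
  have hphys : Ar + flat Ar + flat (G.C * P) * (G.C * P) = 0 := by
    have h := congrArg (fun Z => flat P * Z * P) G.A_add_flat_A
    simp only [Matrix.mul_add, Matrix.add_mul, Matrix.mul_zero, Matrix.zero_mul] at h
    rw [← h, hAr, flat_mul, flat_mul, flat_mul, flat_flat]
    simp only [Matrix.mul_assoc]
  -- `A P = P Ar` modulo `R`. Since `R` is invariant under `A`, hidden from `C` and killed by `P^♭`,
  -- this error is harmless below.
  have hAP : ∀ y, G.A *ᵥ (P *ᵥ y) - P *ᵥ (Ar *ᵥ y) ∈ R := by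
    intro y
    have := hproj _ (hAU _ (hPU y))
    simpa only [hAr, Matrix.mulVec_mulVec, Matrix.mul_assoc] using this
  have hRA : ∀ x ∈ R, G.A *ᵥ x ∈ R := fun x hx => (hR x hx).2.2
  -- If `Ar y = z y` with `Re z ≥ 0`, then `(z - A) P y` lies in `R`; the resolvent preserves `R`,
  -- so `P y` lies in `R` and `y = P^♭ P y = 0`.
  have hArH : IsHurwitzMatrix Ar := by
    intro z hz
    by_contra hre
    rw [not_lt] at hre
    obtain ⟨y, hy0, hy⟩ := mem_spectrum_iff_exists_mulVec.1 hz
    apply hy0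
    have h1 := hAP y
    rw [hy, Matrix.mulVec_smul] at h1
    have h2 : z • (P *ᵥ y) - G.A *ᵥ (P *ᵥ y) ∈ R := by
      rw [← neg_sub]; exact R.neg_mem h1
    have h3 := IsHurwitzMatrix.inv_mulVec_mem hG hRA hre h2
    rw [IsHurwitzMatrix.inv_mulVec_eq hG hre rfl] at h3
    rw [← hcancel y, hflatR _ h3]
  refine ⟨d, P, System.ofAC Ar (G.C * P) hArd (G.doubledUp_C.mul hPd) hphys, hdn, hPP, hPU, hproj,
    ?_, rfl, rfl, ?_⟩
  · rw [System.IsHurwitz, System.ofAC_A]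
    exact hArH
  · intro s hs
    rw [System.ofAC_A, System.ofAC_C]
    refine Matrix.ext_of_mulVec_single fun i => ?_
    generalize (Pi.single i 1 : Doubled d → ℂ) = e
    set y := (s • (1 : Matrix (Doubled d) (Doubled d) ℂ) - Ar)⁻¹ *ᵥ e with hy
    have h1 : s • y - Ar *ᵥ y = e := IsHurwitzMatrix.inv_mulVec_sub hArH hs e
    have h2 : s • (P *ᵥ y) - G.A *ᵥ (P *ᵥ y) = P *ᵥ e - (G.A *ᵥ (P *ᵥ y) - P *ᵥ (Ar *ᵥ y)) := by
      rw [← h1, Matrix.mulVec_sub, Matrix.mulVec_smul]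
      abel
    have h3 := IsHurwitzMatrix.inv_mulVec_eq hG hs h2
    have h4 := IsHurwitzMatrix.inv_mulVec_mem hG hRA hs (hAP y)
    rw [← Matrix.mulVec_mulVec, ← hy, ← Matrix.mulVec_mulVec, ← h3, Matrix.mulVec_sub,
      Matrix.mulVec_sub, (hR _ h4).2.1, sub_zero]
    simp only [Matrix.mulVec_mulVec, Matrix.mul_assoc]

end Reduction

/-! ### Unobservable modes can be removed -/

section Observability

variable {m n : ℕ}

/-- The unobservable subspace of `(C, A)`. -/
def unobs {m n : ℕ} (C : Matrix (Doubled m) (Doubled n) ℂ) (A : Matrix (Doubled n) (Doubled n) ℂ) :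
    Submodule ℂ (Doubled n → ℂ) where
  carrier := {x | ∀ j : ℕ, (C * A ^ j) *ᵥ x = 0}
  add_mem' := fun hx hy j => by rw [Matrix.mulVec_add, hx j, hy j, add_zero]
  zero_mem' := fun j => Matrix.mulVec_zero _
  smul_mem' := fun c x hx j => by rw [Matrix.mulVec_smul, hx j, smul_zero]

variable {C : Matrix (Doubled m) (Doubled n) ℂ} {A : Matrix (Doubled n) (Doubled n) ℂ}

lemma mulVec_eq_zero_of_mem_unobs {x : Doubled n → ℂ} (hx : x ∈ unobs C A) : C *ᵥ x = 0 := by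
  simpa using hx 0

lemma mulVec_mem_unobs {x : Doubled n → ℂ} (hx : x ∈ unobs C A) : A *ᵥ x ∈ unobs C A := by
  intro j
  rw [Matrix.mulVec_mulVec, Matrix.mul_assoc, ← pow_succ]
  exact hx (j + 1)

lemma vconj_mem_unobs (hC : IsDoubledUp C) (hA : IsDoubledUp A) {x : Doubled n → ℂ}
    (hx : x ∈ unobs C A) : vconj x ∈ unobs C A := by
  intro j
  have h := vconj_mulVec (C * A ^ j) x
  rw [hx j, vconj_zero, bar_mul, bar_pow, isDoubledUp_iff.1 hC, isDoubledUp_iff.1 hA] at h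
  exact h.symm

namespace System

variable (G : System m n)

lemma flat_A_mulVec_of_mem_unobs {x : Doubled n → ℂ} (hx : x ∈ unobs G.C G.A) :
    QLin.flat G.A *ᵥ x = -(G.A *ᵥ x) := by
  rw [G.flat_A, Matrix.sub_mulVec, Matrix.neg_mulVec, ← Matrix.mulVec_mulVec,
    mulVec_eq_zero_of_mem_unobs hx, Matrix.mulVec_zero, sub_zero]

/-- On the unobservable subspace `C` vanishes, so `A` is skew for the form there, and uniqueness for
the Lyapunov equation makes the form zero. -/
lemma br_eq_zero_of_mem_unobs (hG : G.IsHurwitz) {x y : Doubled n → ℂ} (hx : x ∈ unobs G.C G.A)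
    (hy : y ∈ unobs G.C G.A) : br x y = 0 := by
  refine lyapunov_unique hG (N := unobs G.C G.A) (fun _ h => mulVec_mem_unobs h) ?_ hx hy
  intro x hx y hy
  change br (G.A *ᵥ x) y + br x (G.A *ᵥ y) = 0
  rw [br_mulVec', G.flat_A_mulVec_of_mem_unobs hy, br_neg_right, neg_add_cancel]

/-- A Hurwitz system which is not observable has the same transfer function as a smaller one. -/
theorem exists_smaller_of_unobs (hG : G.IsHurwitz) {x : Doubled n → ℂ} (hx : x ∈ unobs G.C G.A)
    (hx0 : x ≠ 0) : ∃ (d : ℕ) (K : System m d), d < n ∧ K.IsHurwitz ∧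
      K.S = 1 ∧ ∀ s : ℂ, 0 ≤ s.re → K.transfer s * G.S = G.transfer s := by
  set N := unobs G.C G.A with hN
  let U : Submodule ℂ (Doubled n → ℂ) :=
    { carrier := {y | ∀ x ∈ N, br x y = 0}
      add_mem' := fun hx hy z hz => by rw [br_add_right, hx z hz, hy z hz, add_zero]
      zero_mem' := fun z _ => br_zero_right z
      smul_mem' := fun c x hx z hz => by rw [br_smul_right, hx z hz, mul_zero] }
  have hUd : ∀ y, y ∈ U ↔ ∀ x ∈ N, br x y = 0 := fun y => Iff.rfl
  have hNc : ∀ x ∈ N, vconj x ∈ N := fun x hx => vconj_mem_unobs G.doubledUp_C G.isDoubledUp_A hx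
  have hNU : ∀ x ∈ N, x ∈ U := fun x hx y hy => G.br_eq_zero_of_mem_unobs hG hy hx
  have hUc : ∀ x ∈ U, vconj x ∈ U := by
    intro y hy x hx
    have := br_vconj_vconj (vconj x) y
    rwa [vconj_vconj, hy _ (hNc x hx), star_zero, neg_zero] at this
  have hUA : ∀ x ∈ U, G.A *ᵥ x ∈ U := by
    intro y hy x hx
    rw [br_mulVec, G.flat_A_mulVec_of_mem_unobs hx, br_neg_left, hy _ (mulVec_mem_unobs hx), neg_zero]
  have hCU : ∀ y, QLin.flat G.C *ᵥ y ∈ U := by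
    intro y x hx
    rw [br_mulVec, flat_flat, mulVec_eq_zero_of_mem_unobs hx, br_zero_left]
  -- `U` is the orthogonal complement of `N` and contains the range of every `(C A^j)^♭`. A vector
  -- orthogonal to these ranges is killed by every `C A^j`.
  have hrad : ∀ x ∈ U, (∀ y ∈ U, br y x = 0) → x ∈ N := by
    intro x hx h j
    have hpow : ∀ (j : ℕ) (y : Doubled m → ℂ), QLin.flat (G.C * G.A ^ j) *ᵥ y ∈ U := by
      intro j y x hx
      rw [br_mulVec, flat_flat, hx j, br_zero_left]
    refine eq_zero_of_br_eq_zero fun y => ?_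
    rw [br_mulVec]
    exact h _ (hpow j y)
  obtain ⟨d, P, K, hdn, -, -, hPR, hK, hKS, hKC, hKs⟩ := G.exists_reduction hG U N hUc hUA
    (fun x hx => ⟨fun y hy => br_eq_zero_symm (hy x hx), mulVec_eq_zero_of_mem_unobs hx,
      mulVec_mem_unobs hx⟩) hrad ⟨x, Or.inr ⟨hx, hx0⟩⟩
  refine ⟨d, K, hdn, hK, hKS, fun s hs => ?_⟩
  rw [transfer, transfer, hKS, Matrix.mul_one, hKs s hs, hKC, flat_mul]
  congr 2
  refine Matrix.ext_of_mulVec_single fun i => ?_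
  generalize (Pi.single i 1 : Doubled m → ℂ) = e
  have h1 := hPR _ (hCU e)
  -- Compressing the input `C^♭ e` changes it by a vector of `N`, which the resolvent keeps in `N`
  -- and the output does not see.
  have h2 := mulVec_eq_zero_of_mem_unobs
    (IsHurwitzMatrix.inv_mulVec_mem hG (fun x hx => mulVec_mem_unobs hx) hs h1)
  rw [Matrix.mulVec_sub, Matrix.mulVec_sub, sub_eq_zero] at h2
  simp only [Matrix.mulVec_mulVec, Matrix.mul_assoc] at h2 ⊢
  exact h2.symm

/-- For `s = -iω` both `s` and `-s^#` lie on the boundary of the half-plane where agreement is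
assumed. -/
lemma powerSpectrum_eq_of_transfer {k : ℕ} {G : System m n} {K : System m k}
    {V : Matrix (Doubled m) (Doubled m) ℂ} (h : ∀ s : ℂ, 0 ≤ s.re → K.transfer s = G.transfer s) :
    K.powerSpectrum V = G.powerSpectrum V := by
  ext1 ω
  have h1 : (0 : ℝ) ≤ (-(Complex.I * ω)).re := by simp
  have h2 : (0 : ℝ) ≤ (-(starRingEnd ℂ (-(Complex.I * ω)))).re := by simp
  rw [powerSpectrum, powerSpectrum, spectralDensity, spectralDensity, h _ h1, h _ h2]

variable {G}

theorem IsGloballyMinimal.observable {V : Matrix (Doubled m) (Doubled m) ℂ}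
    (hG : G.IsGloballyMinimal V) (hS : G.S = 1) (x : Doubled n → ℂ)
    (hx : ∀ j : ℕ, (G.C * G.A ^ j) *ᵥ x = 0) : x = 0 := by
  by_contra hx0
  obtain ⟨d, K, hdn, hK, -, hKt⟩ := G.exists_smaller_of_unobs hG.1 hx hx0
  simp only [hS, Matrix.mul_one] at hKt
  exact absurd (hG.2 d K hK (powerSpectrum_eq_of_transfer hKt)) (not_le.2 hdn)

/-- For quantum systems observability implies controllability. -/
lemma controllable_of_observable
    (h : ∀ x : Doubled n → ℂ, (∀ j : ℕ, (G.C * G.A ^ j) *ᵥ x = 0) → x = 0) (x : Doubled n → ℂ)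
    (hx : ∀ j : ℕ, x ᵥ* (G.A ^ j * (-QLin.flat G.C)) = 0) : x = 0 := by
  set y := J n *ᵥ star x with hy
  have hflat_pow : ∀ j : ℕ, QLin.flat (G.A ^ j) = QLin.flat G.A ^ j := by
    intro j
    induction j with
    | zero => simp
    | succ j ih => rw [pow_succ, flat_mul, ih, pow_succ']
  have h1 : ∀ j : ℕ, (G.C * QLin.flat G.A ^ j) *ᵥ y = 0 := by
    intro j
    refine eq_zero_of_br_eq_zero fun z => ?_
    rw [br_mulVec, flat_mul, ← hflat_pow, flat_flat]
    have h2 := congrArg (fun w => w ⬝ᵥ z) (hx j)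
    simp only [Matrix.mul_neg, Matrix.vecMul_neg, neg_dotProduct, zero_dotProduct, neg_eq_zero] at h2
    rw [br, hy, Matrix.mulVec_mulVec, J_mul_J, Matrix.one_mulVec, Matrix.star_dotProduct_star,
      Matrix.dotProduct_mulVec, h2, star_zero]
  -- As `A^♭ = -A - C^♭ C`, and `C` annihilates the vectors `(A^♭)^j y`, the powers of `A^♭` and
  -- `-A` agree on `y`. Hence `y` is unobservable.
  have h3 : ∀ j : ℕ, QLin.flat G.A ^ j *ᵥ y = (-G.A) ^ j *ᵥ y ∧ (G.C * G.A ^ j) *ᵥ y = 0 := by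
    intro j
    have hC : ∀ j, QLin.flat G.A ^ j *ᵥ y = (-G.A) ^ j *ᵥ y → (G.C * G.A ^ j) *ᵥ y = 0 := by
      intro j hj
      have := h1 j
      rw [← Matrix.mulVec_mulVec, hj, neg_pow] at this
      rcases neg_one_pow_eq_or (Matrix (Doubled n) (Doubled n) ℂ) j with e | e <;> rw [e] at this
      · simpa [Matrix.mulVec_mulVec] using this
      · simpa [Matrix.mulVec_mulVec, Matrix.neg_mulVec, Matrix.mulVec_neg] using this
    induction j with
    | zero => exact ⟨by simp, hC 0 (by simp)⟩
    | succ j ih =>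
      have h4 : QLin.flat G.A ^ (j + 1) *ᵥ y = (-G.A) ^ (j + 1) *ᵥ y := by
        have h5 : G.C *ᵥ ((-G.A) ^ j *ᵥ y) = 0 := by
          rw [← ih.1, Matrix.mulVec_mulVec, h1 j]
        rw [pow_succ', ← Matrix.mulVec_mulVec, ih.1, G.flat_A, Matrix.sub_mulVec,
          ← Matrix.mulVec_mulVec, h5, Matrix.mulVec_zero, sub_zero, Matrix.mulVec_mulVec, ← pow_succ']
      exact ⟨h4, hC _ h4⟩
  have h6 := h y fun j => (h3 j).2
  have h7 : star x = 0 := by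
    rw [← Matrix.one_mulVec (star x), ← J_mul_J, ← Matrix.mulVec_mulVec, ← hy, h6,
      Matrix.mulVec_zero]
  simpa using h7

end System

end Observability

/-! ### Right half-plane zeros can be removed -/

section Cavity

variable {m n : ℕ}

namespace System

lemma transfer_mulVec {G : System m n} (hS : G.S = 1) (s : ℂ) (v : Doubled m → ℂ) :
    G.transfer s *ᵥ v = v - G.C *ᵥ
      ((s • (1 : Matrix (Doubled n) (Doubled n) ℂ) - G.A)⁻¹ *ᵥ (QLin.flat G.C *ᵥ v)) := by
  rw [transfer, hS, Matrix.mul_one, Matrix.sub_mulVec, Matrix.one_mulVec, Matrix.mulVec_mulVec,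
    Matrix.mulVec_mulVec, Matrix.mul_assoc]

/-- On the imaginary axis the transfer function preserves the indefinite form. -/
lemma br_transfer_mulVec {G : System m n} (hS : G.S = 1) (hG : G.IsHurwitz) {s : ℂ} (hs : s.re = 0)
    (v : Doubled m → ℂ) : br (G.transfer s *ᵥ v) (G.transfer s *ᵥ v) = br v v := by
  rw [transfer_mulVec hS]
  set x := (s • (1 : Matrix (Doubled n) (Doubled n) ℂ) - G.A)⁻¹ *ᵥ (QLin.flat G.C *ᵥ v) with hx
  have h1 : s • x - G.A *ᵥ x = QLin.flat G.C *ᵥ v := IsHurwitzMatrix.inv_mulVec_sub hG hs.ge _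
  have h2 : br (G.C *ᵥ x) v = s * br x x - br x (G.A *ᵥ x) := by
    rw [br_mulVec', ← h1, br_sub_right, br_smul_right]
  have h3 : br v (G.C *ᵥ x) = star s * br x x - br x (QLin.flat G.A *ᵥ x) := by
    rw [br_mulVec, ← h1, br_sub_left, br_smul_left, br_mulVec' G.A]
  have h4 : br (G.C *ᵥ x) (G.C *ᵥ x) = -br x (G.A *ᵥ x) - br x (QLin.flat G.A *ᵥ x) := by
    rw [br_mulVec', G.flat_A, Matrix.mulVec_mulVec, Matrix.sub_mulVec, Matrix.neg_mulVec,
      br_sub_right, br_neg_right]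
    ring
  have h5 : s + star s = 0 := by
    have := Complex.add_conj s
    rw [hs] at this
    simpa using this
  rw [br_sub_left, br_sub_right, br_sub_right, h2, h3, h4]
  linear_combination (-br x x) * h5

/-- A right half-plane zero of the transfer function in a direction of square one can be removed by
splitting off one mode at the input. -/
theorem exists_smaller_of_zero {G : System m n} (hS : G.S = 1) (hG : G.IsHurwitz)
    {v : Doubled m → ℂ} (hv : br v v = 1) {z : ℂ} (hz : 0 < z.re) (h0 : G.transfer z *ᵥ v = 0) :
    ∃ (d : ℕ) (K : System m d), d < n ∧ K.IsHurwitz ∧ K.S = 1 ∧ ∀ s : ℂ, 0 ≤ s.re → s ≠ z →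
      K.transfer s *ᵥ v = ((s + star z) / (s - z)) • (G.transfer s *ᵥ v) := by
  rw [transfer_mulVec hS] at h0
  set x := (z • (1 : Matrix (Doubled n) (Doubled n) ℂ) - G.A)⁻¹ *ᵥ (QLin.flat G.C *ᵥ v) with hx
  have h1 : z • x - G.A *ᵥ x = QLin.flat G.C *ᵥ v := IsHurwitzMatrix.inv_mulVec_sub hG hz.le _
  have hCx : G.C *ᵥ x = v := (sub_eq_zero.1 h0).symm
  -- The zero condition reads `C x = v`, which makes `x` an eigenvector of `A^♭`; so is its
  -- conjugate, and the orthogonal complement of the pair is invariant under `A`.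
  have hAx : QLin.flat G.A *ᵥ x = -(z • x) := by
    rw [G.flat_A, Matrix.sub_mulVec, Matrix.neg_mulVec, ← Matrix.mulVec_mulVec, hCx, ← h1]
    abel
  have hAx' : QLin.flat G.A *ᵥ vconj x = -(star z • vconj x) := by
    have := vconj_mulVec (QLin.flat G.A) x
    rw [bar_flat, isDoubledUp_iff.1 G.isDoubledUp_A, hAx] at this
    rw [← this, ← neg_smul, vconj_smul, star_neg, neg_smul]
  -- This shows that `x` is not isotropic, so the span of `x` and its conjugate splits off
  -- orthogonally.
  have hq : (z + star z) * br x x = 1 := by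
    have h2 : br x (G.A *ᵥ x) = -(star z * br x x) := by
      rw [br_mulVec, hAx, br_neg_left, br_smul_left]
    have h3 : br x (QLin.flat G.C *ᵥ v) = 1 := by
      rw [br_mulVec, flat_flat, hCx, hv]
    rw [← h1, br_sub_right, br_smul_right, h2] at h3
    linear_combination h3
  have hq0 : br x x ≠ 0 := fun h => by simp [h] at hq
  have hq0' : br (vconj x) (vconj x) ≠ 0 := by
    rw [br_vconj_vconj, neg_ne_zero, star_br]
    exact hq0
  have hxv : br (vconj x) x = 0 := br_eq_zero_symm (br_vconj_self x)
  let U : Submodule ℂ (Doubled n → ℂ) :=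
    { carrier := {y | br x y = 0 ∧ br (vconj x) y = 0}
      add_mem' := fun ha hb => by
        constructor <;> simp only [br_add_right, ha.1, ha.2, hb.1, hb.2, add_zero]
      zero_mem' := ⟨br_zero_right _, br_zero_right _⟩
      smul_mem' := fun c a ha => by
        constructor <;> simp only [br_smul_right, ha.1, ha.2, mul_zero] }
  have hUc : ∀ y ∈ U, vconj y ∈ U := by
    rintro y ⟨ha, hb⟩
    constructor
    · have := br_vconj_vconj (vconj x) y
      rwa [vconj_vconj, hb, star_zero, neg_zero] at this
    · rw [br_vconj_vconj, ha, star_zero, neg_zero]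
  have hUA : ∀ y ∈ U, G.A *ᵥ y ∈ U := by
    rintro y ⟨ha, hb⟩
    constructor
    · rw [br_mulVec, hAx, br_neg_left, br_smul_left, ha, mul_zero, neg_zero]
    · rw [br_mulVec, hAx', br_neg_left, br_smul_left, hb, mul_zero, neg_zero]
  have hrad : ∀ y ∈ U, (∀ w ∈ U, br w y = 0) → y ∈ (⊥ : Submodule ℂ (Doubled n → ℂ)) := by
    rintro y ⟨ha, hb⟩ h
    rw [Submodule.mem_bot]
    refine eq_zero_of_br_eq_zero fun w => ?_
    have hw : w - (br x w / br x x) • x - (br (vconj x) w / br (vconj x) (vconj x)) • vconj x ∈ U := by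
      constructor
      · rw [br_sub_right, br_sub_right, br_smul_right, br_smul_right, br_vconj_self]
        field_simp
        ring
      · rw [br_sub_right, br_sub_right, br_smul_right, br_smul_right, hxv]
        field_simp
        ring
    have := h _ hw
    rw [br_sub_left, br_sub_left, br_smul_left, br_smul_left, ha, hb] at this
    simpa using this
  obtain ⟨d, P, K, hdn, hPP, hPU, hPR, hK, hKS, hKC, hKs⟩ := G.exists_reduction hG U ⊥ hUc hUA
    (fun y hy => by
      rw [Submodule.mem_bot] at hy
      subst hy
      simp) hrad ⟨x, Or.inl fun h => hq0 h.1⟩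
  refine ⟨d, K, hdn, hK, hKS, fun s hs hsz => ?_⟩
  have hPx : QLin.flat P *ᵥ x = 0 := by
    refine eq_zero_of_br_eq_zero fun w => ?_
    rw [br_mulVec, flat_flat]
    exact br_eq_zero_symm (hPU w).1
  -- The component of `C^♭ v` along `x` is `(z + z^#) x`, and the one along the conjugate of `x`
  -- vanishes because `v` is orthogonal to its own conjugate.
  have hmem : QLin.flat G.C *ᵥ v - (z + star z) • x ∈ U := by
    constructor
    · rw [br_sub_right, br_smul_right, br_mulVec, flat_flat, hCx, hv, hq, sub_self]
    · have := vconj_mulVec G.C x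
      rw [isDoubledUp_iff.1 G.doubledUp_C, hCx] at this
      rw [br_sub_right, br_smul_right, br_mulVec, flat_flat, ← this, hxv,
        br_eq_zero_symm (br_vconj_self v), mul_zero, sub_zero]
  have hproj : P *ᵥ (QLin.flat P *ᵥ (QLin.flat G.C *ᵥ v)) =
      QLin.flat G.C *ᵥ v - (z + star z) • x := by
    have := hPR _ hmem
    rw [Submodule.mem_bot, sub_eq_zero, Matrix.mulVec_sub, Matrix.mulVec_smul, hPx, smul_zero,
      sub_zero] at this
    exact this.symm
  set Rs := (s • (1 : Matrix (Doubled n) (Doubled n) ℂ) - G.A)⁻¹ with hRs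
  -- From `(s - A) x = (s - z) x + (z - A) x`. Applying `C` gives `(s - z) C (s - A)⁻¹ x = Ξ(s) v`,
  -- the source of the all-pass factor.
  have hx2 : Rs *ᵥ ((s - z) • x + QLin.flat G.C *ᵥ v) = x := by
    refine IsHurwitzMatrix.inv_mulVec_eq hG hs ?_
    rw [← h1]
    module
  have hsz' : s - z ≠ 0 := sub_ne_zero.2 hsz
  have hCRx : G.C *ᵥ (Rs *ᵥ x) = (s - z)⁻¹ • (G.transfer s *ᵥ v) := by
    rw [transfer_mulVec hS, eq_inv_smul_iff₀ hsz', ← hRs, eq_sub_iff_add_eq]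
    rw [Matrix.mulVec_add, Matrix.mulVec_smul] at hx2
    rw [← Matrix.mulVec_smul, ← Matrix.mulVec_add, hx2, hCx]
  have hKv : K.transfer s *ᵥ v = v - G.C *ᵥ (Rs *ᵥ (P *ᵥ (QLin.flat P *ᵥ (QLin.flat G.C *ᵥ v)))) := by
    rw [transfer_mulVec hKS, Matrix.mulVec_mulVec, hKs s hs, hKC, flat_mul]
    simp only [Matrix.mulVec_mulVec, Matrix.mul_assoc, hRs]
  rw [hKv, hproj, Matrix.mulVec_sub, Matrix.mulVec_sub, Matrix.mulVec_smul, Matrix.mulVec_smul,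
    hCRx, sub_sub_eq_add_sub, add_sub_right_comm, ← transfer_mulVec hS, smul_smul]
  nth_rewrite 1 [← one_smul ℂ (G.transfer s *ᵥ v)]
  rw [← add_smul]
  congr 1
  field_simp
  ring

lemma powerSpectrum_vecMulVec (G : System m n) (v : Doubled m → ℂ) (ω : ℝ) :
    G.powerSpectrum (Matrix.vecMulVec v (star v)) ω =
      Matrix.vecMulVec (G.transfer (-(Complex.I * ω)) *ᵥ v)
        (star (G.transfer (-(Complex.I * ω)) *ᵥ v)) := by
  have h : -(starRingEnd ℂ (-(Complex.I * ω))) = -(Complex.I * ω) := by simp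
  rw [powerSpectrum, spectralDensity, h, Matrix.mul_vecMulVec, Matrix.vecMulVec_mul,
    Matrix.star_mulVec]

/-- A globally minimal system is zero-free in the closed right half-plane along a pure input. -/
theorem IsGloballyMinimal.transfer_mulVec_ne_zero {G : System m n} {v : Doubled m → ℂ}
    (hv : br v v = 1) (hG : G.IsGloballyMinimal (Matrix.vecMulVec v (star v))) (hS : G.S = 1) {z : ℂ}
    (hz : 0 ≤ z.re) : G.transfer z *ᵥ v ≠ 0 := by
  intro h0
  rcases hz.eq_or_lt with hz | hz
  -- A zero on the axis is impossible because there `Ξ(s) v` keeps the square one of `v`.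
  · have := br_transfer_mulVec hS hG.1 hz.symm v
    rw [h0, br_zero_right, hv] at this
    exact zero_ne_one this
  · obtain ⟨d, K, hdn, hK, -, hKs⟩ := exists_smaller_of_zero hS hG.1 hv hz h0
    refine absurd (hG.2 d K hK ?_) (not_le.2 hdn)
    ext1 ω
    have hne : -(Complex.I * ω) ≠ z := by
      rintro rfl
      simp at hz
    rw [powerSpectrum_vecMulVec, powerSpectrum_vecMulVec, hKs _ (by simp) hne, star_smul,
      Matrix.smul_vecMulVec, Matrix.vecMulVec_smul, smul_smul]
    have hne' : -(Complex.I * ω) - z ≠ 0 := sub_ne_zero.2 hne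
    have hne2 : star (-(Complex.I * ω) - z) ≠ 0 := star_ne_zero.2 hne'
    have hunit : (-(Complex.I * ω) + star z) / (-(Complex.I * ω) - z) *
        star ((-(Complex.I * ω) + star z) / (-(Complex.I * ω) - z)) = 1 := by
      rw [star_div₀, div_mul_div_comm, div_eq_one_iff_eq (mul_ne_zero hne' hne2)]
      simp only [star_add, star_sub, star_neg, star_mul', Complex.star_def, Complex.conj_conj,
        Complex.conj_I, Complex.conj_ofReal]
      ring
    rw [hunit, one_smul]

end System

end Cavity

open Filter Topology Bornology

/-! ### Analyticity and decay of resolvents -/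

section ResolventRegularity

open scoped Matrix.Norms.Operator

variable {ι : Type*} [Fintype ι] [DecidableEq ι]

lemma resolvent_eq_inv (A : Matrix ι ι ℂ) (s : ℂ) :
    resolvent A s = (s • (1 : Matrix ι ι ℂ) - A)⁻¹ := by
  rw [resolvent, Algebra.algebraMap_eq_smul_one, Matrix.nonsing_inv_eq_ringInverse]

lemma differentiableAt_inv_smul_sub (A : Matrix ι ι ℂ) (ℓ : Matrix ι ι ℂ →ₗ[ℂ] ℂ) {s : ℂ}
    (hs : s ∉ spectrum ℂ A) :
    DifferentiableAt ℂ (fun s : ℂ => ℓ (s • (1 : Matrix ι ι ℂ) - A)⁻¹) s := by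
  have h1 : DifferentiableAt ℂ (resolvent A) s :=
    (spectrum.hasDerivAt_resolvent_const_left (spectrum.notMem_iff.1 hs)).differentiableAt
  have h2 := (LinearMap.toContinuousLinearMap ℓ).differentiableAt.comp s h1
  simp only [← resolvent_eq_inv]
  exact h2

lemma tendsto_inv_smul_sub (A : Matrix ι ι ℂ) (ℓ : Matrix ι ι ℂ →ₗ[ℂ] ℂ) :
    Tendsto (fun s : ℂ => ℓ (s • (1 : Matrix ι ι ℂ) - A)⁻¹) (cobounded ℂ) (𝓝 0) := by
  have h1 := spectrum.resolvent_tendsto_cobounded (𝕜 := ℂ) A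
  have h2 := ((LinearMap.toContinuousLinearMap ℓ).continuous.tendsto 0).comp h1
  rw [map_zero] at h2
  simp only [← resolvent_eq_inv]
  exact h2

end ResolventRegularity

section MatrixResolvent

variable {ι : Type*} [Fintype ι] [DecidableEq ι]

lemma tendsto_mul_inv_mul (A : Matrix ι ι ℂ) {α β : Type*} (C : Matrix α ι ℂ) (B : Matrix ι β ℂ) :
    Tendsto (fun s : ℂ => C * (s • (1 : Matrix ι ι ℂ) - A)⁻¹ * B) (cobounded ℂ) (𝓝 0) := by
  refine tendsto_pi_nhds.2 fun i => tendsto_pi_nhds.2 fun j => ?_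
  exact tendsto_inv_smul_sub A
    { toFun := fun X => (C * X * B) i j
      map_add' := fun X Y => by simp [Matrix.mul_add, Matrix.add_mul]
      map_smul' := fun c X => by simp }

end MatrixResolvent

/-! ### Uniqueness of zero-free factors of a rank-one spectrum -/

section HalfPlane

/-- Phragmen-Lindelöf in the right half-plane for functions with a limit at infinity. -/
lemma norm_le_of_tendsto {f : ℂ → ℂ} {c : ℂ} {M : ℝ} (hd : DiffContOnCl ℂ f {z | 0 < z.re})
    (hlim : Tendsto f (cobounded ℂ) (𝓝 c)) (him : ∀ y : ℝ, ‖f (y * Complex.I)‖ ≤ M) {z : ℂ}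
    (hz : 0 ≤ z.re) : ‖f z‖ ≤ M := by
  refine PhragmenLindelof.right_half_plane_of_bounded_on_real hd ⟨0, by norm_num, 0, ?_⟩ ?_ him hz
  · simp only [zero_mul, Real.exp_zero]
    exact (hlim.isBigO_one ℝ).mono inf_le_left
  · have h := (hlim.comp (RCLike.tendsto_ofReal_atTop_cobounded ℂ)).norm
    exact h.isBoundedUnder_le

/-- A function on the right half-plane which together with its inverse has modulus at most one on
the boundary, and tends to one at infinity, is constant. -/
lemma eq_one_of_tendsto {f g : ℂ → ℂ} (hf : DiffContOnCl ℂ f {z | 0 < z.re})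
    (hg : DiffContOnCl ℂ g {z | 0 < z.re}) (hflim : Tendsto f (cobounded ℂ) (𝓝 1))
    (hglim : Tendsto g (cobounded ℂ) (𝓝 1)) (hfi : ∀ y : ℝ, ‖f (y * Complex.I)‖ ≤ 1)
    (hgi : ∀ y : ℝ, ‖g (y * Complex.I)‖ ≤ 1) (hfg : ∀ z : ℂ, 0 ≤ z.re → f z * g z = 1) {z : ℂ}
    (hz : 0 ≤ z.re) : f z = 1 := by
  have hf1 : ∀ z : ℂ, 0 ≤ z.re → ‖f z‖ ≤ 1 := fun z hz => norm_le_of_tendsto hf hflim hfi hz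
  have hg1 : ∀ z : ℂ, 0 ≤ z.re → ‖g z‖ ≤ 1 := fun z hz => norm_le_of_tendsto hg hglim hgi hz
  have hn : ∀ z : ℂ, 0 ≤ z.re → 1 ≤ ‖f z‖ := by
    intro z hz
    have h := congrArg norm (hfg z hz)
    rw [norm_mul, norm_one] at h
    nlinarith [hf1 z hz, hg1 z hz, norm_nonneg (f z), norm_nonneg (g z)]
  have hconv : Convex ℝ {z : ℂ | 0 < z.re} := convex_halfSpace_re_gt 0
  have hopen : IsOpen {z : ℂ | 0 < z.re} := isOpen_lt continuous_const Complex.continuous_re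
  have hmem : (1 : ℂ) ∈ {z : ℂ | 0 < z.re} := by simp
  -- Both `f` and its inverse are bounded by one, so `|f| = 1` throughout and every interior point
  -- is a maximum; `1` is an arbitrary choice.
  have hmax : IsMaxOn (norm ∘ f) {z : ℂ | 0 < z.re} 1 := fun w hw =>
    (hf1 w (le_of_lt hw)).trans (hn 1 (by simp))
  have hconst := Complex.eqOn_closure_of_isPreconnected_of_isMaxOn_norm hconv.isPreconnected hopen hf
    hmem hmax
  rw [Complex.closure_setOfPred_lt_re] at hconst
  have hlim : Tendsto (fun x : ℝ => f x) atTop (𝓝 1) := hflim.comp (RCLike.tendsto_ofReal_atTop_cobounded ℂ)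
  have h1 : f 1 = 1 := by
    refine tendsto_nhds_unique (tendsto_const_nhds.congr' ?_) hlim
    filter_upwards [eventually_ge_atTop 0] with x hx
    exact (hconst (x := (x : ℂ)) (by simpa using hx)).symm
  exact (hconst hz).trans h1

variable {ι : Type*} [Fintype ι]

/-- The quotient `w₂† w₁ / w₂† w₂`. -/
def ratio (w₁ w₂ : ι → ℂ) : ℂ := (star w₂ ⬝ᵥ w₁) / (star w₂ ⬝ᵥ w₂)

open scoped ComplexOrder in
lemma star_dotProduct_ne_zero {w : ι → ℂ} (hw : w ≠ 0) : star w ⬝ᵥ w ≠ 0 :=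
  fun h => hw (dotProduct_star_self_eq_zero.1 h)

/-- Vanishing minors mean proportionality. Dividing by `w₂† w₂` reads off the factor without
choosing a nonvanishing coordinate. -/
lemma ratio_smul {w₁ w₂ : ι → ℂ} (h2 : w₂ ≠ 0) (h : ∀ i j, w₁ i * w₂ j = w₁ j * w₂ i) :
    w₁ = ratio w₁ w₂ • w₂ := by
  ext i
  rw [Pi.smul_apply, smul_eq_mul, ratio, div_mul_eq_mul_div, eq_div_iff (star_dotProduct_ne_zero h2)]
  simp only [dotProduct, Finset.mul_sum, Finset.sum_mul]
  refine Finset.sum_congr rfl fun k _ => ?_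
  linear_combination star w₂ k * h i k

lemma norm_ratio {w₁ w₂ : ι → ℂ} (h2 : w₂ ≠ 0) (h : ∀ i j, w₁ i * w₂ j = w₁ j * w₂ i)
    (hw : Matrix.vecMulVec w₁ (star w₁) = Matrix.vecMulVec w₂ (star w₂)) : ‖ratio w₁ w₂‖ = 1 := by
  have e := ratio_smul h2 h
  obtain ⟨k, hk⟩ := Function.ne_iff.1 h2
  rw [Pi.zero_apply] at hk
  have h3 := congrFun (congrFun hw k) k
  simp only [Matrix.vecMulVec_apply, Pi.star_apply] at h3
  have h4 : ‖w₁ k‖ = ‖w₂ k‖ := by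
    have := congrArg norm h3
    rw [norm_mul, norm_mul, norm_star, norm_star] at this
    exact (mul_self_inj (norm_nonneg _) (norm_nonneg _)).1 this
  have h5 := congrArg norm (congrFun e k)
  rw [Pi.smul_apply, smul_eq_mul, norm_mul, h4] at h5
  exact mul_right_cancel₀ (norm_ne_zero_iff.2 hk) (by rw [← h5, one_mul])

lemma diffContOnCl_ratio {w₁ w₂ : ℂ → ι → ℂ}
    (hd₁ : ∀ j, DiffContOnCl ℂ (fun s => w₁ s j) {z | 0 < z.re})
    (hd₂ : ∀ j, DiffContOnCl ℂ (fun s => w₂ s j) {z | 0 < z.re})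
    (hz₂ : ∀ s : ℂ, 0 ≤ s.re → w₂ s ≠ 0)
    (h : ∀ s : ℂ, 0 ≤ s.re → ∀ i j, w₁ s i * w₂ s j = w₁ s j * w₂ s i) :
    DiffContOnCl ℂ (fun s => ratio (w₁ s) (w₂ s)) {z | 0 < z.re} := by
  have hopen : IsOpen {z : ℂ | 0 < z.re} := isOpen_lt continuous_const Complex.continuous_re
  constructor
  · intro s hs
    obtain ⟨k, hk⟩ := Function.ne_iff.1 (hz₂ s (le_of_lt hs))
    have h1 : DifferentiableAt ℂ (fun s => w₁ s k) s :=
      (hd₁ k).differentiableOn.differentiableAt (hopen.mem_nhds hs)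
    have h2 : DifferentiableAt ℂ (fun s => w₂ s k) s :=
      (hd₂ k).differentiableOn.differentiableAt (hopen.mem_nhds hs)
    -- The formula for `ratio` contains conjugates, so holomorphy is read off from the local
    -- expression `w₁ k / w₂ k`.
    refine (DifferentiableAt.congr_of_eventuallyEq (h1.div h2 hk) ?_).differentiableWithinAt
    filter_upwards [h2.continuousAt.eventually_ne hk, hopen.mem_nhds hs] with t ht ht'
    have h3 := congrFun (ratio_smul (hz₂ t (le_of_lt ht')) (h t (le_of_lt ht'))) k
    rw [Pi.smul_apply, smul_eq_mul] at h3
    simp only [Pi.div_apply]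
    rw [eq_div_iff ht, ← h3]
  · rw [Complex.closure_setOfPred_lt_re]
    have hc₁ : ∀ j, ContinuousOn (fun s => w₁ s j) {z : ℂ | 0 ≤ z.re} := fun j => by
      have := (hd₁ j).continuousOn
      rwa [Complex.closure_setOfPred_lt_re] at this
    have hc₂ : ∀ j, ContinuousOn (fun s => w₂ s j) {z : ℂ | 0 ≤ z.re} := fun j => by
      have := (hd₂ j).continuousOn
      rwa [Complex.closure_setOfPred_lt_re] at this
    refine ContinuousOn.div ?_ ?_ fun s hs => star_dotProduct_ne_zero (hz₂ s hs)
    · exact continuousOn_finsetSum _ fun j _ => (hc₂ j).star.mul (hc₁ j)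
    · exact continuousOn_finsetSum _ fun j _ => (hc₂ j).star.mul (hc₂ j)

lemma tendsto_ratio {w₁ w₂ : ℂ → ι → ℂ} {v : ι → ℂ} (hv : v ≠ 0)
    (h₁ : ∀ j, Tendsto (fun s => w₁ s j) (cobounded ℂ) (𝓝 (v j)))
    (h₂ : ∀ j, Tendsto (fun s => w₂ s j) (cobounded ℂ) (𝓝 (v j))) :
    Tendsto (fun s => ratio (w₁ s) (w₂ s)) (cobounded ℂ) (𝓝 1) := by
  rw [← div_self (star_dotProduct_ne_zero hv)]
  refine Tendsto.div ?_ ?_ (star_dotProduct_ne_zero hv)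
  · exact tendsto_finsetSum _ fun j _ => (h₂ j).star.mul (h₁ j)
  · exact tendsto_finsetSum _ fun j _ => (h₂ j).star.mul (h₂ j)

/-- Uniqueness of zero-free stable factors of rank-one spectra. -/
theorem eq_of_vecMulVec_eq {w₁ w₂ : ℂ → ι → ℂ} {v : ι → ℂ} (hv : v ≠ 0)
    (hd₁ : ∀ j, DiffContOnCl ℂ (fun s => w₁ s j) {z | 0 < z.re})
    (hd₂ : ∀ j, DiffContOnCl ℂ (fun s => w₂ s j) {z | 0 < z.re})
    (h₁ : ∀ j, Tendsto (fun s => w₁ s j) (cobounded ℂ) (𝓝 (v j)))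
    (h₂ : ∀ j, Tendsto (fun s => w₂ s j) (cobounded ℂ) (𝓝 (v j)))
    (hz₁ : ∀ s : ℂ, 0 ≤ s.re → w₁ s ≠ 0) (hz₂ : ∀ s : ℂ, 0 ≤ s.re → w₂ s ≠ 0)
    (haxis : ∀ y : ℝ, Matrix.vecMulVec (w₁ (y * Complex.I)) (star (w₁ (y * Complex.I))) =
      Matrix.vecMulVec (w₂ (y * Complex.I)) (star (w₂ (y * Complex.I)))) {s : ℂ} (hs : 0 ≤ s.re) :
    w₁ s = w₂ s := by
  have hre : ∀ y : ℝ, 0 ≤ (y * Complex.I : ℂ).re := fun y => by simp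
  -- The minors vanish on the axis, where the rank-one matrices agree, and Phragmen-Lindelöf with
  -- bound `0` spreads this over the half-plane.
  have hprop : ∀ s : ℂ, 0 ≤ s.re → ∀ i j, w₁ s i * w₂ s j = w₁ s j * w₂ s i := by
    intro s hs i j
    rw [← sub_eq_zero, ← norm_le_zero_iff]
    refine norm_le_of_tendsto (f := fun s => w₁ s i * w₂ s j - w₁ s j * w₂ s i)
      (c := v i * v j - v j * v i) (((hd₁ i).smul (hd₂ j)).sub ((hd₁ j).smul (hd₂ i)))
      (((h₁ i).mul (h₂ j)).sub ((h₁ j).mul (h₂ i))) (fun y => ?_) hs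
    rw [norm_le_zero_iff]
    obtain ⟨k, hk⟩ := Function.ne_iff.1 (hz₁ _ (hre y))
    have e1 := congrFun (congrFun (haxis y) i) k
    have e2 := congrFun (congrFun (haxis y) j) k
    simp only [Matrix.vecMulVec_apply, Pi.star_apply] at e1 e2
    have hk' : star (w₁ (y * Complex.I) k) ≠ 0 := star_ne_zero.2 hk
    apply mul_right_cancel₀ hk'
    linear_combination w₂ (y * Complex.I) j * e1 - w₂ (y * Complex.I) i * e2
  have hprop' : ∀ s : ℂ, 0 ≤ s.re → ∀ i j, w₂ s i * w₁ s j = w₂ s j * w₁ s i := fun s hs i j => by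
    rw [mul_comm, ← hprop s hs i j, mul_comm]
  have hu : ratio (w₁ s) (w₂ s) = 1 := by
    refine eq_one_of_tendsto (f := fun s => ratio (w₁ s) (w₂ s)) (g := fun s => ratio (w₂ s) (w₁ s))
      (diffContOnCl_ratio hd₁ hd₂ hz₂ hprop) (diffContOnCl_ratio hd₂ hd₁ hz₁ hprop')
      (tendsto_ratio hv h₁ h₂) (tendsto_ratio hv h₂ h₁)
      (fun y => (norm_ratio (hz₂ _ (hre y)) (hprop _ (hre y)) (haxis y)).le)
      (fun y => (norm_ratio (hz₁ _ (hre y)) (hprop' _ (hre y)) (haxis y).symm).le)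
      (fun z hz => ?_) hs
    have e1 := ratio_smul (hz₂ z hz) (hprop z hz)
    have e2 := ratio_smul (hz₁ z hz) (hprop' z hz)
    obtain ⟨k, hk⟩ := Function.ne_iff.1 (hz₁ z hz)
    have e3 := congrFun e1 k
    rw [Pi.smul_apply, congrFun e2 k, Pi.smul_apply, smul_eq_mul, smul_eq_mul, ← mul_assoc] at e3
    exact mul_right_cancel₀ hk (by rw [one_mul]; exact e3.symm)
  have h := ratio_smul (hz₂ s hs) (hprop s hs)
  rwa [hu, one_smul] at h

end HalfPlane

/-! ### The response to a pure input is determined by the spectrum -/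

namespace System

variable {m n : ℕ}

lemma diffContOnCl_transfer_mulVec {G : System m n} (hS : G.S = 1) (hG : G.IsHurwitz)
    (v : Doubled m → ℂ) (j : Doubled m) :
    DiffContOnCl ℂ (fun s => (G.transfer s *ᵥ v) j) {z | 0 < z.re} := by
  have hd : ∀ s : ℂ, 0 ≤ s.re → DifferentiableAt ℂ (fun s => (G.transfer s *ᵥ v) j) s := by
    intro s hs
    simp only [transfer_mulVec hS, Pi.sub_apply]
    refine (differentiableAt_const _).sub ?_
    exact differentiableAt_inv_smul_sub G.A
      { toFun := fun X => (G.C *ᵥ (X *ᵥ (QLin.flat G.C *ᵥ v))) j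
        map_add' := fun X Y => by simp only [Matrix.add_mulVec, Matrix.mulVec_add, Pi.add_apply]
        map_smul' := fun c X => by
          simp only [Matrix.smul_mulVec, Matrix.mulVec_smul, Pi.smul_apply, RingHom.id_apply] }
      (fun h => absurd (hG s h) (not_lt.2 hs))
  constructor
  · exact fun s hs => (hd s (le_of_lt hs)).differentiableWithinAt
  · rw [Complex.closure_setOfPred_lt_re]
    exact fun s hs => (hd s hs).continuousAt.continuousWithinAt

lemma tendsto_transfer (G : System m n) : Tendsto G.transfer (cobounded ℂ) (𝓝 G.S) := by
  have h := tendsto_mul_inv_mul G.A G.C (QLin.flat G.C)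
  have h1 := (tendsto_const_nhds (x := (1 : Matrix (Doubled m) (Doubled m) ℂ))).sub h
  have hc : Continuous fun X : Matrix (Doubled m) (Doubled m) ℂ => X * G.S :=
    continuous_id.matrix_mul continuous_const
  have h2 := (hc.tendsto (1 - 0)).comp h1
  rw [sub_zero, Matrix.one_mul] at h2
  exact h2

lemma tendsto_transfer_mulVec {G : System m n} (hS : G.S = 1) (v : Doubled m → ℂ) (j : Doubled m) :
    Tendsto (fun s => (G.transfer s *ᵥ v) j) (cobounded ℂ) (𝓝 (v j)) := by
  have h : Continuous fun X : Matrix (Doubled m) (Doubled m) ℂ => (X *ᵥ v) j :=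
    (continuous_apply j).comp (continuous_id.matrix_mulVec continuous_const)
  have h1 := (h.tendsto _).comp G.tendsto_transfer
  simpa [hS, Function.comp_def] using h1

/-- Two globally minimal systems with the same spectrum agree along a pure input direction. -/
theorem transfer_mulVec_eq {k : ℕ} {G : System m n} {K : System m k} {v : Doubled m → ℂ}
    (hv : br v v = 1) (hGS : G.S = 1) (hKS : K.S = 1)
    (hG : G.IsGloballyMinimal (Matrix.vecMulVec v (star v)))
    (hK : K.IsGloballyMinimal (Matrix.vecMulVec v (star v)))
    (h : G.powerSpectrum (Matrix.vecMulVec v (star v)) =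
      K.powerSpectrum (Matrix.vecMulVec v (star v))) {s : ℂ} (hs : 0 ≤ s.re) :
    G.transfer s *ᵥ v = K.transfer s *ᵥ v := by
  refine eq_of_vecMulVec_eq (w₁ := fun s => G.transfer s *ᵥ v) (w₂ := fun s => K.transfer s *ᵥ v)
    (v := v) (fun h0 => by simp [h0] at hv) (diffContOnCl_transfer_mulVec hGS hG.1 v)
    (diffContOnCl_transfer_mulVec hKS hK.1 v) (tendsto_transfer_mulVec hGS v)
    (tendsto_transfer_mulVec hKS v) (fun s hs => hG.transfer_mulVec_ne_zero hv hGS hs)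
    (fun s hs => hK.transfer_mulVec_ne_zero hv hKS hs) (fun y => ?_) hs
  have e := congrFun h (-y)
  rw [powerSpectrum_vecMulVec, powerSpectrum_vecMulVec] at e
  have e2 : -(Complex.I * ((-y : ℝ) : ℂ)) = y * Complex.I := by
    push_cast
    ring
  rwa [e2] at e

end System

/-! ### Markov parameters -/

section Markov

variable {m k l : ℕ}

lemma tendsto_axis : Tendsto (fun ω : ℝ => -(Complex.I * ω)) atTop (cobounded ℂ) := by
  rw [← tendsto_norm_atTop_iff_cobounded]
  simpa using tendsto_abs_atTop_atTop

lemma eventually_notMem_spectrum {n : ℕ} (A : Matrix (Doubled n) (Doubled n) ℂ) :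
    ∀ᶠ ω : ℝ in atTop, -(Complex.I * ω) ∉ spectrum ℂ A := by
  have hfin : (spectrum ℂ A).Finite := A.finite_spectrum
  exact tendsto_axis.eventually (isBounded_def.1 hfin.isBounded)

lemma smul_mul_inv_mul {n : ℕ} {A : Matrix (Doubled n) (Doubled n) ℂ} {s : ℂ}
    (hs : s ∉ spectrum ℂ A) (C : Matrix (Doubled m) (Doubled n) ℂ)
    (B : Matrix (Doubled n) (Doubled m) ℂ) :
    s • (C * (s • (1 : Matrix (Doubled n) (Doubled n) ℂ) - A)⁻¹ * B) =
      C * B + C * (s • (1 : Matrix (Doubled n) (Doubled n) ℂ) - A)⁻¹ * (A * B) := by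
  have hu : IsUnit (s • (1 : Matrix (Doubled n) (Doubled n) ℂ) - A).det := by
    rw [← Matrix.isUnit_iff_isUnit_det, ← Algebra.algebraMap_eq_smul_one]
    exact spectrum.notMem_iff.1 hs
  have h := Matrix.nonsing_inv_mul _ hu
  rw [Matrix.mul_sub, Matrix.mul_smul, Matrix.mul_one, sub_eq_iff_eq_add] at h
  rw [← Matrix.smul_mul, ← Matrix.mul_smul, h, Matrix.mul_add, Matrix.add_mul, Matrix.mul_one]
  simp only [Matrix.mul_assoc]

/-- Transfer functions which agree on the imaginary axis near infinity have the same Markov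
parameters. -/
theorem markov_eq {A : Matrix (Doubled k) (Doubled k) ℂ} {B : Matrix (Doubled k) (Doubled m) ℂ}
    {C : Matrix (Doubled m) (Doubled k) ℂ} {A' : Matrix (Doubled l) (Doubled l) ℂ}
    {B' : Matrix (Doubled l) (Doubled m) ℂ} {C' : Matrix (Doubled m) (Doubled l) ℂ}
    (h : ∀ᶠ ω : ℝ in atTop,
      C * ((-(Complex.I * ω)) • (1 : Matrix (Doubled k) (Doubled k) ℂ) - A)⁻¹ * B =
      C' * ((-(Complex.I * ω)) • (1 : Matrix (Doubled l) (Doubled l) ℂ) - A')⁻¹ * B') (j : ℕ) :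
    C * A ^ j * B = C' * A' ^ j * B' := by
  -- By `s C (s - A)⁻¹ B = C B + C (s - A)⁻¹ A B`, the limit at infinity isolates `C B`, and what
  -- remains has the same shape with `A B` in place of `B`.
  have step : ∀ (B : Matrix (Doubled k) (Doubled m) ℂ) (B' : Matrix (Doubled l) (Doubled m) ℂ),
      (∀ᶠ ω : ℝ in atTop,
        C * ((-(Complex.I * ω)) • (1 : Matrix (Doubled k) (Doubled k) ℂ) - A)⁻¹ * B =
        C' * ((-(Complex.I * ω)) • (1 : Matrix (Doubled l) (Doubled l) ℂ) - A')⁻¹ * B') →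
      C * B = C' * B' ∧ ∀ᶠ ω : ℝ in atTop,
        C * ((-(Complex.I * ω)) • (1 : Matrix (Doubled k) (Doubled k) ℂ) - A)⁻¹ * (A * B) =
        C' * ((-(Complex.I * ω)) • (1 : Matrix (Doubled l) (Doubled l) ℂ) - A')⁻¹ * (A' * B') := by
    intro B B' h
    have h1 : ∀ᶠ ω : ℝ in atTop,
        C * B + C * ((-(Complex.I * ω)) • (1 : Matrix (Doubled k) (Doubled k) ℂ) - A)⁻¹ * (A * B) =
        C' * B' +
          C' * ((-(Complex.I * ω)) • (1 : Matrix (Doubled l) (Doubled l) ℂ) - A')⁻¹ * (A' * B') := by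
      filter_upwards [h, eventually_notMem_spectrum A, eventually_notMem_spectrum A'] with ω h h1 h2
      rw [← smul_mul_inv_mul h1, ← smul_mul_inv_mul h2, h]
    have h2 : C * B = C' * B' := by
      have t1 := (tendsto_const_nhds (x := C * B)).add
        ((tendsto_mul_inv_mul A C (A * B)).comp tendsto_axis)
      have t2 := (tendsto_const_nhds (x := C' * B')).add
        ((tendsto_mul_inv_mul A' C' (A' * B')).comp tendsto_axis)
      rw [add_zero] at t1 t2
      exact tendsto_nhds_unique (t1.congr' h1) t2
    refine ⟨h2, ?_⟩
    filter_upwards [h1] with ω h1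
    rw [h2] at h1
    exact add_left_cancel h1
  have hall : ∀ j : ℕ, ∀ᶠ ω : ℝ in atTop,
      C * ((-(Complex.I * ω)) • (1 : Matrix (Doubled k) (Doubled k) ℂ) - A)⁻¹ * (A ^ j * B) =
      C' * ((-(Complex.I * ω)) • (1 : Matrix (Doubled l) (Doubled l) ℂ) - A')⁻¹ * (A' ^ j * B') := by
    intro j
    induction j with
    | zero => simpa using h
    | succ j ih =>
      simpa only [pow_succ', Matrix.mul_assoc] using (step _ _ ih).2
  simpa only [Matrix.mul_assoc] using (step _ _ (hall j)).1

end Markov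

/-! ### Similarity of minimal realisations -/

section Kalman

variable {m k l : ℕ}

/-- The observability map `x ↦ (C Aʲ x)ⱼ`. -/
def obsMap (A : Matrix (Doubled k) (Doubled k) ℂ) (C : Matrix (Doubled m) (Doubled k) ℂ) :
    (Doubled k → ℂ) →ₗ[ℂ] (ℕ → Doubled m → ℂ) :=
  LinearMap.pi fun j => Matrix.mulVecLin (C * A ^ j)

/-- The controllability map `(uⱼ) ↦ ∑ⱼ Aʲ B uⱼ`. -/
def ctrlMap (A : Matrix (Doubled k) (Doubled k) ℂ) (B : Matrix (Doubled k) (Doubled m) ℂ) :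
    (ℕ →₀ (Doubled m → ℂ)) →ₗ[ℂ] (Doubled k → ℂ) :=
  Finsupp.lsum ℂ fun j => Matrix.mulVecLin (A ^ j * B)

lemma obsMap_apply (A : Matrix (Doubled k) (Doubled k) ℂ) (C : Matrix (Doubled m) (Doubled k) ℂ)
    (x : Doubled k → ℂ) (j : ℕ) : obsMap A C x j = (C * A ^ j) *ᵥ x := rfl

lemma ctrlMap_single (A : Matrix (Doubled k) (Doubled k) ℂ) (B : Matrix (Doubled k) (Doubled m) ℂ)
    (j : ℕ) (u : Doubled m → ℂ) : ctrlMap A B (Finsupp.single j u) = (A ^ j * B) *ᵥ u := by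
  simp [ctrlMap]

lemma obsMap_injective {A : Matrix (Doubled k) (Doubled k) ℂ} {C : Matrix (Doubled m) (Doubled k) ℂ}
    (h : ∀ x : Doubled k → ℂ, (∀ j : ℕ, (C * A ^ j) *ᵥ x = 0) → x = 0) :
    LinearMap.ker (obsMap A C) = ⊥ := by
  rw [LinearMap.ker_eq_bot']
  exact fun x hx => h x fun j => congrFun hx j

/-- By duality: a functional vanishing on the reachable subspace is a row vector annihilating every
`A^j B`. -/
lemma ctrlMap_surjective {A : Matrix (Doubled k) (Doubled k) ℂ}
    {B : Matrix (Doubled k) (Doubled m) ℂ}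
    (h : ∀ x : Doubled k → ℂ, (∀ j : ℕ, x ᵥ* (A ^ j * B) = 0) → x = 0) :
    LinearMap.range (ctrlMap A B) = ⊤ := by
  by_contra hne
  obtain ⟨f, hf, hle⟩ := Submodule.exists_le_ker_of_lt_top _ (lt_top_iff_ne_top.2 hne)
  apply hf
  set x : Doubled k → ℂ := fun i => f (Pi.single i 1) with hx
  have hfx : ∀ y, f y = x ⬝ᵥ y := by
    intro y
    have e : ∀ i : Doubled k, (fun j => if i = j then (1 : ℂ) else 0) = Pi.single i 1 := by
      intro i
      ext j
      simp [Pi.single_apply, eq_comm]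
    rw [LinearMap.pi_apply_eq_sum_univ f y]
    simp only [e, dotProduct, hx, smul_eq_mul, mul_comm]
  have hx0 : x = 0 := by
    refine h x fun j => ?_
    refine dotProduct_eq_zero _ fun u => ?_
    rw [← Matrix.dotProduct_mulVec, ← hfx, ← ctrlMap_single]
    exact hle ⟨_, rfl⟩
  ext i
  simpa using congrFun hx0 i

/-- Kalman: minimal realisations with the same Markov parameters are similar. -/
theorem exists_similarity {A : Matrix (Doubled k) (Doubled k) ℂ}
    {B : Matrix (Doubled k) (Doubled m) ℂ}
    {C : Matrix (Doubled m) (Doubled k) ℂ} {A' : Matrix (Doubled l) (Doubled l) ℂ}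
    {B' : Matrix (Doubled l) (Doubled m) ℂ} {C' : Matrix (Doubled m) (Doubled l) ℂ}
    (hO : ∀ x : Doubled k → ℂ, (∀ j : ℕ, (C * A ^ j) *ᵥ x = 0) → x = 0)
    (hK : ∀ x : Doubled k → ℂ, (∀ j : ℕ, x ᵥ* (A ^ j * B) = 0) → x = 0)
    (hO' : ∀ x : Doubled l → ℂ, (∀ j : ℕ, (C' * A' ^ j) *ᵥ x = 0) → x = 0)
    (hK' : ∀ x : Doubled l → ℂ, (∀ j : ℕ, x ᵥ* (A' ^ j * B') = 0) → x = 0)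
    (h : ∀ j, C * A ^ j * B = C' * A' ^ j * B') :
    ∃ (T : Matrix (Doubled l) (Doubled k) ℂ) (T' : Matrix (Doubled k) (Doubled l) ℂ),
      T' * T = 1 ∧ T * T' = 1 ∧ T * A = A' * T ∧ T * B = B' ∧ C' * T = C := by
  obtain ⟨L, hL⟩ := (obsMap A C).exists_leftInverse_of_injective (obsMap_injective hO)
  obtain ⟨L', hL'⟩ := (obsMap A' C').exists_leftInverse_of_injective (obsMap_injective hO')
  have hs := ctrlMap_surjective hK
  have hs' := ctrlMap_surjective hK'
  -- Both sides are the Hankel operator, whose entries are the Markov parameters.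
  have hHankel : obsMap A C ∘ₗ ctrlMap A B = obsMap A' C' ∘ₗ ctrlMap A' B' := by
    refine Finsupp.lhom_ext fun j u => ?_
    funext i
    simp only [LinearMap.comp_apply, ctrlMap_single, obsMap_apply, Matrix.mulVec_mulVec]
    have := h (i + j)
    rw [pow_add, pow_add] at this
    simp only [Matrix.mul_assoc] at this ⊢
    rw [this]
  have hLO : ∀ x, L (obsMap A C x) = x := fun x => LinearMap.congr_fun hL x
  have hLO' : ∀ x, L' (obsMap A' C' x) = x := fun x => LinearMap.congr_fun hL' x
  have hH : ∀ p, obsMap A C (ctrlMap A B p) = obsMap A' C' (ctrlMap A' B' p) := fun p =>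
    LinearMap.congr_fun hHankel p
  set T := LinearMap.toMatrix' (L' ∘ₗ obsMap A C) with hT
  set T' := LinearMap.toMatrix' (L ∘ₗ obsMap A' C') with hT'
  -- `T` sends the state reached by an input sequence in the first realisation to the state reached
  -- by the same sequence in the second. Since all states are reachable, identities need checking
  -- only there.
  have hTx : ∀ x, T *ᵥ x = L' (obsMap A C x) := fun x => by
    rw [hT, LinearMap.toMatrix'_mulVec, LinearMap.comp_apply]
  have hTx' : ∀ x, T' *ᵥ x = L (obsMap A' C' x) := fun x => by
    rw [hT', LinearMap.toMatrix'_mulVec, LinearMap.comp_apply]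
  have hTK : ∀ p, T *ᵥ ctrlMap A B p = ctrlMap A' B' p := fun p => by rw [hTx, hH, hLO']
  have hTK' : ∀ p, T' *ᵥ ctrlMap A' B' p = ctrlMap A B p := fun p => by rw [hTx', ← hH, hLO]
  have hshift : ∀ (n : ℕ) (A : Matrix (Doubled n) (Doubled n) ℂ)
      (B : Matrix (Doubled n) (Doubled m) ℂ) (p : ℕ →₀ (Doubled m → ℂ)),
      A *ᵥ ctrlMap A B p = ctrlMap A B (Finsupp.lmapDomain _ ℂ Nat.succ p) := by
    intro n A B p
    have : Matrix.mulVecLin A ∘ₗ ctrlMap A B =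
        ctrlMap A B ∘ₗ Finsupp.lmapDomain _ ℂ Nat.succ := by
      refine Finsupp.lhom_ext fun j u => ?_
      simp [ctrlMap_single, Matrix.mulVec_mulVec, pow_succ', Matrix.mul_assoc]
    exact LinearMap.congr_fun this p
  have ext_of_surj : ∀ {n r : ℕ} {A : Matrix (Doubled n) (Doubled n) ℂ}
      {B : Matrix (Doubled n) (Doubled m) ℂ} (_ : LinearMap.range (ctrlMap A B) = ⊤)
      {X Y : Matrix (Doubled r) (Doubled n) ℂ},
      (∀ p, X *ᵥ ctrlMap A B p = Y *ᵥ ctrlMap A B p) → X = Y := by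
    intro n r A B hr X Y hXY
    refine Matrix.ext_of_mulVec_single fun i => ?_
    obtain ⟨p, hp⟩ := LinearMap.range_eq_top.1 hr (Pi.single i 1)
    rw [← hp]
    exact hXY p
  refine ⟨T, T', ext_of_surj hs fun p => ?_, ext_of_surj hs' fun p => ?_, ext_of_surj hs fun p => ?_,
    ?_, ext_of_surj hs fun p => ?_⟩
  · rw [← Matrix.mulVec_mulVec, hTK, hTK', Matrix.one_mulVec]
  · rw [← Matrix.mulVec_mulVec, hTK', hTK, Matrix.one_mulVec]
  · rw [← Matrix.mulVec_mulVec, ← Matrix.mulVec_mulVec, hTK, hshift, hshift, hTK]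
  · refine Matrix.ext_of_mulVec_single fun i => ?_
    have := hTK (Finsupp.single 0 (Pi.single i 1))
    rwa [ctrlMap_single, ctrlMap_single, pow_zero, pow_zero, Matrix.one_mul, Matrix.one_mul,
      Matrix.mulVec_mulVec] at this
  · have := congrFun (hH p) 0
    rw [obsMap_apply, obsMap_apply, pow_zero, pow_zero, Matrix.mul_one, Matrix.mul_one] at this
    rw [← Matrix.mulVec_mulVec, hTK, this]

/-- A similarity between doubled-up observable realisations is doubled-up. -/
lemma isDoubledUp_of_similarity {A : Matrix (Doubled k) (Doubled k) ℂ}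
    {C : Matrix (Doubled m) (Doubled k) ℂ} {A' : Matrix (Doubled l) (Doubled l) ℂ}
    {C' : Matrix (Doubled m) (Doubled l) ℂ} {T : Matrix (Doubled l) (Doubled k) ℂ}
    (hO' : ∀ x : Doubled l → ℂ, (∀ j : ℕ, (C' * A' ^ j) *ᵥ x = 0) → x = 0)
    (hA : IsDoubledUp A) (hC : IsDoubledUp C) (hA' : IsDoubledUp A') (hC' : IsDoubledUp C')
    (hTA : T * A = A' * T) (hTC : C' * T = C) : IsDoubledUp T := by
  rw [isDoubledUp_iff] at *
  have key : ∀ X : Matrix (Doubled l) (Doubled k) ℂ, X * A = A' * X → C' * X = C →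
      ∀ j, C' * A' ^ j * X = C * A ^ j := by
    intro X hXA hXC j
    have : ∀ j, X * A ^ j = A' ^ j * X := by
      intro j
      induction j with
      | zero => simp
      | succ j ih => rw [pow_succ, ← Matrix.mul_assoc, ih, Matrix.mul_assoc, hXA, ← Matrix.mul_assoc,
          ← pow_succ]
    rw [Matrix.mul_assoc, ← this, ← Matrix.mul_assoc, hXC]
  -- The conjugate of `T` intertwines the same realisations, and observability allows only one such
  -- matrix.
  have h1 : bar T * A = A' * bar T := by
    have := congrArg bar hTA
    rwa [bar_mul, bar_mul, hA, hA'] at this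
  have h2 : C' * bar T = C := by
    have := congrArg bar hTC
    rwa [bar_mul, hC, hC'] at this
  refine Matrix.ext_of_mulVec_single fun i => ?_
  rw [← sub_eq_zero]
  refine hO' _ fun j => ?_
  rw [Matrix.mulVec_sub, Matrix.mulVec_mulVec, Matrix.mulVec_mulVec, key _ h1 h2, key _ hTA hTC,
    sub_self]

end Kalman

/-! ### Pure inputs of one channel -/

section PureInput

/-- The vacuum covariance is `e e†` with `e` of square one; the witness is `v = T⁻¹ e = T^♭ e`, and
symplectic maps preserve the form. -/
lemma exists_vecMulVec_of_isPureInput {N M : Matrix (Fin 1) (Fin 1) ℂ} (h : IsPureInput N M) :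
    ∃ v : Doubled 1 → ℂ, br v v = 1 ∧ inputCovariance N M = Matrix.vecMulVec v (star v) := by
  obtain ⟨-, -, T, ⟨-, hT1, hT2⟩, hT⟩ := h
  set e : Doubled 1 → ℂ := Pi.single (Sum.inl 0) 1 with he
  have hD : inputCovariance (0 : Matrix (Fin 1) (Fin 1) ℂ) 0 = Matrix.vecMulVec e (star e) := by
    ext i j
    rcases i with i | i <;> rcases j with j | j <;> fin_cases i <;> fin_cases j <;>
      simp [inputCovariance, he, Matrix.vecMulVec_apply]
  refine ⟨flat T *ᵥ e, ?_, ?_⟩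
  · rw [br_mulVec', flat_flat, Matrix.mulVec_mulVec, hT2, Matrix.one_mulVec, br_apply]
    simp [he]
  · have h1 : Tᴴ * (flat T)ᴴ = 1 := by rw [← Matrix.conjTranspose_mul, hT1, Matrix.conjTranspose_one]
    rw [Matrix.star_mulVec, ← Matrix.vecMulVec_mul, ← Matrix.mul_vecMulVec, ← hD, ← hT]
    calc inputCovariance N M = flat T * T * inputCovariance N M * (Tᴴ * (flat T)ᴴ) := by
          rw [hT1, h1, Matrix.one_mul, Matrix.mul_one]
      _ = _ := by simp only [Matrix.mul_assoc]

/-- For one channel a matrix is determined by its values on a vector of square one and its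
conjugate. -/
lemma eq_of_mulVec_eq {v : Doubled 1 → ℂ} (hv : br v v = 1)
    {X Y : Matrix (Doubled 1) (Doubled 1) ℂ} (h1 : X *ᵥ v = Y *ᵥ v)
    (h2 : X *ᵥ vconj v = Y *ᵥ vconj v) : X = Y := by
  have hP : SymplecticFamily fun _ : Fin 1 => v := by
    constructor
    · intro i j
      simp [hv, Subsingleton.elim i j]
    · intro i j
      exact br_vconj_self v
  have hPP := mul_eq_one_comm.1 hP.flat_mul_self
  have h : X * dcols (fun _ : Fin 1 => v) = Y * dcols (fun _ : Fin 1 => v) := by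
    refine Matrix.ext_of_mulVec_single fun i => ?_
    rw [← Matrix.mulVec_mulVec, ← Matrix.mulVec_mulVec, dcols_mulVec, Matrix.mulVec_sum,
      Matrix.mulVec_sum]
    refine Finset.sum_congr rfl fun k _ => ?_
    rw [Matrix.mulVec_add, Matrix.mulVec_add, Matrix.mulVec_smul, Matrix.mulVec_smul,
      Matrix.mulVec_smul, Matrix.mulVec_smul, h1, h2]
  have h' := congrArg (fun Z => Z * flat (dcols fun _ : Fin 1 => v)) h
  simpa only [Matrix.mul_assoc, hPP, Matrix.mul_one] using h'

end PureInput

/-! ### Similarity, symplectic equivalence and Lyapunov solutions -/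

section Equivalence

variable {m n k l : ℕ}

lemma eq_of_mul_eq_one {T : Matrix (Doubled l) (Doubled k) ℂ} {T' : Matrix (Doubled k) (Doubled l) ℂ}
    (h1 : T' * T = 1) (h2 : T * T' = 1) : k = l := by
  have h := (Matrix.toLin'OfInv h1 h2).finrank_eq
  simp at h
  omega

lemma isHurwitzMatrix_of_similarity {A : Matrix (Doubled k) (Doubled k) ℂ}
    {A' : Matrix (Doubled l) (Doubled l) ℂ} {T : Matrix (Doubled l) (Doubled k) ℂ}
    {T' : Matrix (Doubled k) (Doubled l) ℂ} (hT : T' * T = 1) (hTA : T * A = A' * T)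
    (hA' : IsHurwitzMatrix A') : IsHurwitzMatrix A := by
  intro z hz
  obtain ⟨x, hx0, hx⟩ := mem_spectrum_iff_exists_mulVec.1 hz
  refine hA' z (mem_spectrum_iff_exists_mulVec.2 ⟨T *ᵥ x, fun h => hx0 ?_, ?_⟩)
  · rw [← Matrix.one_mulVec x, ← hT, ← Matrix.mulVec_mulVec, h, Matrix.mulVec_zero]
  · rw [Matrix.mulVec_mulVec, ← hTA, ← Matrix.mulVec_mulVec, hx, Matrix.mulVec_smul]

namespace System

lemma J_mul_Ω (G : System m n) :
    J n * G.Ω = Complex.I • (G.A + (1 / 2 : ℂ) • (QLin.flat G.C * G.C)) := by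
  have h : G.A + (1 / 2 : ℂ) • (QLin.flat G.C * G.C) = -(Complex.I • (J n * G.Ω)) := by
    rw [A]
    module
  rw [h, smul_neg, smul_smul, Complex.I_mul_I, neg_one_smul, neg_neg]

lemma A_eq (G : System m n) :
    G.A = -((1 / 2 : ℂ) • (QLin.flat G.C * G.C)) - Complex.I • (J n * G.Ω) := rfl

lemma lyapunov (G : System m n) : J n * G.A + G.Aᴴ * J n + G.Cᴴ * J m * G.C = 0 := by
  have h := congrArg (fun Z => J n * Z) G.A_add_flat_A
  simpa only [Matrix.mul_add, QLin.flat, Matrix.mul_assoc, J_mul_cancel, Matrix.mul_zero] using h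

/-- Physical realisability, multiplied by `J`, is a Lyapunov equation with solution `J`; congruence
by `T` transports it to the other realisation. -/
lemma lyapunov_of_similarity (G : System m l) {A₀ : Matrix (Doubled k) (Doubled k) ℂ}
    {C₀ : Matrix (Doubled m) (Doubled k) ℂ} {T : Matrix (Doubled l) (Doubled k) ℂ}
    (hTA : T * A₀ = G.A * T) (hTC : G.C * T = C₀) :
    (Tᴴ * J l * T) * A₀ + A₀ᴴ * (Tᴴ * J l * T) + C₀ᴴ * J m * C₀ = 0 := by
  have h := congrArg (fun Z => Tᴴ * Z * T) G.lyapunov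
  have hTA' : A₀ᴴ * Tᴴ = Tᴴ * G.Aᴴ := by
    rw [← Matrix.conjTranspose_mul, hTA, Matrix.conjTranspose_mul]
  rw [← hTC, Matrix.conjTranspose_mul, Matrix.mul_assoc _ T A₀, hTA,
    show A₀ᴴ * (Tᴴ * J l * T) = A₀ᴴ * Tᴴ * (J l * T) by simp only [Matrix.mul_assoc], hTA']
  simpa only [Matrix.mul_add, Matrix.add_mul, Matrix.mul_assoc, Matrix.mul_zero,
    Matrix.zero_mul] using h

/-- `A`-level form of symplectic equivalence. -/
lemma symplecticEquiv_of_similarity {G : System m k} {K : System m l} (hS : G.S = K.S)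
    {T : Matrix (Doubled l) (Doubled k) ℂ} (hT : IsSymplectic T) (hTA : T * G.A = K.A * T)
    (hTC : K.C * T = G.C) : G.SymplecticEquiv K := by
  have hA : K.A = T * G.A * QLin.flat T := by
    rw [hTA, Matrix.mul_assoc, hT.2.2, Matrix.mul_one]
  have hC : K.C = G.C * QLin.flat T := by
    rw [← hTC, Matrix.mul_assoc, hT.2.2, Matrix.mul_one]
  refine ⟨hS, T, hT, ?_, hC⟩
  rw [J_mul_Ω, J_mul_Ω, hA, hC, flat_mul, flat_flat]
  simp only [Matrix.mul_smul, Matrix.smul_mul, Matrix.mul_add, Matrix.add_mul, Matrix.mul_assoc]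

lemma SymplecticEquiv.transfer_eq {G : System m k} {K : System m l} (h : G.SymplecticEquiv K)
    (hG : G.IsHurwitz) : k = l ∧ K.IsHurwitz ∧
      ∀ s : ℂ, 0 ≤ s.re → K.transfer s = G.transfer s := by
  obtain ⟨hS, T, hT, hΩ, hC⟩ := h
  have hA : K.A = T * G.A * QLin.flat T := by
    rw [A_eq, A_eq, hΩ, hC, flat_mul, flat_flat]
    simp only [Matrix.mul_smul, Matrix.smul_mul, Matrix.mul_sub, Matrix.sub_mul, Matrix.mul_neg,
      Matrix.neg_mul, Matrix.mul_assoc]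
  refine ⟨eq_of_mul_eq_one hT.2.1 hT.2.2, ?_, fun s hs => ?_⟩
  · refine isHurwitzMatrix_of_similarity (T := QLin.flat T) (T' := T) (A' := G.A) hT.2.2 ?_ hG
    rw [hA, ← Matrix.mul_assoc, ← Matrix.mul_assoc, hT.2.1, Matrix.one_mul]
  · have hinv : (s • (1 : Matrix (Doubled l) (Doubled l) ℂ) - K.A)⁻¹ =
        T * (s • (1 : Matrix (Doubled k) (Doubled k) ℂ) - G.A)⁻¹ * QLin.flat T := by
      refine Matrix.inv_eq_right_inv ?_
      have h1 : s • (1 : Matrix (Doubled l) (Doubled l) ℂ) - K.A =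
          T * (s • (1 : Matrix (Doubled k) (Doubled k) ℂ) - G.A) * QLin.flat T := by
        rw [hA, Matrix.mul_sub, Matrix.sub_mul, Matrix.mul_smul, Matrix.smul_mul, Matrix.mul_one,
          hT.2.2]
      rw [h1]
      calc _ = T * (s • (1 : Matrix (Doubled k) (Doubled k) ℂ) - G.A) * (QLin.flat T * T) *
            (s • (1 : Matrix (Doubled k) (Doubled k) ℂ) - G.A)⁻¹ * QLin.flat T := by
            simp only [Matrix.mul_assoc]
        _ = 1 := by
            rw [hT.2.1, Matrix.mul_one, Matrix.mul_assoc T,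
              Matrix.mul_nonsing_inv _ (IsHurwitzMatrix.isUnit_det hG hs), Matrix.mul_one, hT.2.2]
    rw [transfer, transfer, hinv, hC, ← hS, flat_mul, flat_flat]
    congr 2
    calc _ = G.C * (QLin.flat T * T) * (s • (1 : Matrix (Doubled k) (Doubled k) ℂ) - G.A)⁻¹ *
          (QLin.flat T * T) * QLin.flat G.C := by simp only [Matrix.mul_assoc]
      _ = _ := by rw [hT.2.1, Matrix.mul_one, Matrix.mul_one]

lemma freqTransfer_eq_of_transfer {G : System m n} {K : System m k}
    (h : ∀ s : ℂ, 0 ≤ s.re → K.transfer s = G.transfer s) : K.freqTransfer = G.freqTransfer := by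
  ext1 ω
  exact h _ (by simp)

variable {V : Matrix (Doubled m) (Doubled m) ℂ} {Ψ : ℝ → Matrix (Doubled m) (Doubled m) ℂ}

lemma IsGloballyMinimalRealisation.of_symplecticEquiv {G : System m k} {K : System m l}
    (hG : G.IsGloballyMinimalRealisation V Ψ) (h : G.SymplecticEquiv K) :
    K.IsGloballyMinimalRealisation V Ψ ∧ K.freqTransfer = G.freqTransfer := by
  obtain ⟨hkl, hK, ht⟩ := h.transfer_eq hG.2.2.1
  have hp := powerSpectrum_eq_of_transfer (V := V) ht
  refine ⟨⟨h.1 ▸ hG.1, hp.trans hG.2.1, hK, fun j L hL hLp => ?_⟩, freqTransfer_eq_of_transfer ht⟩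
  rw [← hkl]
  exact hG.2.2.2 j L hL (hLp.trans hp)

lemma isMinimalClassicalRealisation {G : System m n} (hG : G.IsGloballyMinimal V) (hS : G.S = 1) :
    IsMinimalClassicalRealisation G.A (-QLin.flat G.C) G.C G.freqTransfer where
  doubledUp_A := G.isDoubledUp_A
  doubledUp_B := G.doubledUp_C.flat.neg
  doubledUp_C := G.doubledUp_C
  observable := hG.observable hS
  controllable := controllable_of_observable (hG.observable hS)
  transfer_eq := fun ω _ => by
    rw [freqTransfer, transfer, hS, Matrix.mul_one, Matrix.mul_neg, sub_eq_add_neg]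

end System

lemma IsMinimalClassicalRealisation.exists_similarity {A : Matrix (Doubled k) (Doubled k) ℂ}
    {B : Matrix (Doubled k) (Doubled m) ℂ} {C : Matrix (Doubled m) (Doubled k) ℂ}
    {A' : Matrix (Doubled l) (Doubled l) ℂ} {B' : Matrix (Doubled l) (Doubled m) ℂ}
    {C' : Matrix (Doubled m) (Doubled l) ℂ} {Ξ : ℝ → Matrix (Doubled m) (Doubled m) ℂ}
    (h : IsMinimalClassicalRealisation A B C Ξ) (h' : IsMinimalClassicalRealisation A' B' C' Ξ) :
    ∃ (T : Matrix (Doubled l) (Doubled k) ℂ) (T' : Matrix (Doubled k) (Doubled l) ℂ),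
      IsDoubledUp T ∧ T' * T = 1 ∧ T * T' = 1 ∧ T * A = A' * T ∧ C' * T = C := by
  obtain ⟨T, T', h1, h2, h3, -, h4⟩ := QLin.exists_similarity h.observable h.controllable h'.observable
    h'.controllable (markov_eq (by
      filter_upwards [eventually_notMem_spectrum A, eventually_notMem_spectrum A'] with ω e1 e2
      have := (h.transfer_eq ω e1).symm.trans (h'.transfer_eq ω e2)
      exact add_left_cancel this))
  exact ⟨T, T', isDoubledUp_of_similarity h'.observable h.doubledUp_A h.doubledUp_C h'.doubledUp_A
    h'.doubledUp_C h3 h4, h1, h2, h3, h4⟩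

lemma lyapunov_solution_unique {A Q X Y : Matrix (Doubled n) (Doubled n) ℂ} (hA : IsHurwitzMatrix A)
    (hX : X * A + Aᴴ * X + Q = 0) (hY : Y * A + Aᴴ * Y + Q = 0) : X = Y := by
  rw [← sub_eq_zero]
  refine lyapunov_unique_matrix hA ?_
  rw [Matrix.sub_mul, Matrix.mul_sub, ← sub_eq_zero.2 (hX.trans hY.symm)]
  abel

/-! ### Quantum realisations from classical ones, and their uniqueness -/

namespace System

variable {V : Matrix (Doubled m) (Doubled m) ℂ} {Ψ : ℝ → Matrix (Doubled m) (Doubled m) ℂ}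

/-- Globally minimal realisations with the same transfer function are symplectically equivalent. -/
theorem symplecticEquiv_of_freqTransfer_eq {G : System m k} {K : System m l}
    (hG : G.IsGloballyMinimalRealisation V Ψ) (hK : K.IsGloballyMinimalRealisation V Ψ)
    (h : G.freqTransfer = K.freqTransfer) : G.SymplecticEquiv K := by
  have hGr := isMinimalClassicalRealisation hG.2.2 hG.1
  have hKr := isMinimalClassicalRealisation hK.2.2 hK.1
  rw [h] at hGr
  obtain ⟨T, T', hTd, h1, h2, hTA, hTC⟩ := hGr.exists_similarity hKr
  obtain rfl := eq_of_mul_eq_one h1 h2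
  -- `T† J T` and `J` solve the same Lyapunov equation for the Hurwitz matrix of `G`, so they
  -- coincide and `T` is symplectic.
  have hX := lyapunov_solution_unique hG.2.2.1 (K.lyapunov_of_similarity hTA hTC) G.lyapunov
  have hfl : QLin.flat T * T = 1 := by
    rw [QLin.flat, Matrix.mul_assoc, Matrix.mul_assoc, ← Matrix.mul_assoc Tᴴ, hX, J_mul_J]
  exact symplecticEquiv_of_similarity (hG.1.trans hK.1.symm)
    ⟨hTd, hfl, mul_eq_one_comm.1 hfl⟩ hTA hTC

/-- Construction of a quantum system from a classical realisation of its transfer function. -/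
theorem exists_of_isPhysicalTransformation {G : System m l}
    (hG : G.IsGloballyMinimalRealisation V Ψ) {A₀ : Matrix (Doubled k) (Doubled k) ℂ}
    {B₀ : Matrix (Doubled k) (Doubled m) ℂ} {C₀ : Matrix (Doubled m) (Doubled k) ℂ}
    (h : IsMinimalClassicalRealisation A₀ B₀ C₀ G.freqTransfer) :
    (∃ T, IsPhysicalTransformation A₀ C₀ T) ∧ ∀ T, IsPhysicalTransformation A₀ C₀ T →
      ∃ K : System m k, K.C = C₀ * T⁻¹ ∧
        K.Ω = Complex.I • (J k * (T * A₀ * T⁻¹ +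
          (1 / 2 : ℂ) • (QLin.flat (C₀ * T⁻¹) * (C₀ * T⁻¹)))) ∧
        K.freqTransfer = G.freqTransfer ∧ K.IsGloballyMinimalRealisation V Ψ := by
  obtain ⟨R, R', hRd, h1, h2, hRA, hRC⟩ :=
    h.exists_similarity (isMinimalClassicalRealisation hG.2.2 hG.1)
  obtain rfl := eq_of_mul_eq_one h1 h2
  -- Stability of the classical realisation is not assumed; it follows from the Kalman similarity
  -- `R` with `G`.
  have hA₀ : IsHurwitzMatrix A₀ := isHurwitzMatrix_of_similarity h1 hRA hG.2.2.1
  have hRl := G.lyapunov_of_similarity hRA hRC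
  refine ⟨⟨R, hRd, IsUnit.of_mul_eq_one R' h2, hRl⟩, ?_⟩
  rintro T ⟨hTd, hTu, hTl⟩
  have hX := lyapunov_solution_unique hA₀ hTl hRl
  rw [Matrix.isUnit_iff_isUnit_det] at hTu
  have hT1 := Matrix.nonsing_inv_mul _ hTu
  have hR' : IsDoubledUp R' := by
    rw [← Matrix.inv_eq_right_inv h2]
    exact hRd.inv
  have hflat : QLin.flat T * T = QLin.flat R * R := by
    have := congrArg (fun Z => J k * Z) hX
    simpa only [QLin.flat, Matrix.mul_assoc] using this
  -- `T† J T = R† J R` makes `T R⁻¹` symplectic, and this matrix carries `G` to the system built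
  -- from `T`.
  have hWW : QLin.flat (T * R') * (T * R') = 1 := by
    calc QLin.flat (T * R') * (T * R') = QLin.flat R' * (QLin.flat T * T) * R' := by
          rw [flat_mul]; simp only [Matrix.mul_assoc]
      _ = QLin.flat (R * R') * (R * R') := by
          rw [hflat, flat_mul]; simp only [Matrix.mul_assoc]
      _ = 1 := by rw [h2, flat_one, Matrix.one_mul]
  have hW : IsSymplectic (T * R') := ⟨hTd.mul hR', hWW, mul_eq_one_comm.1 hWW⟩
  have hWA : T * R' * G.A = T * A₀ * T⁻¹ * (T * R') := by
    calc T * R' * G.A = T * R' * (G.A * R) * R' := by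
          rw [Matrix.mul_assoc, Matrix.mul_assoc, Matrix.mul_assoc, Matrix.mul_assoc, h2,
            Matrix.mul_one]
      _ = T * (R' * R) * A₀ * (T⁻¹ * T) * R' := by
          rw [← hRA, hT1]; simp only [Matrix.mul_assoc, Matrix.one_mul]
      _ = T * A₀ * T⁻¹ * (T * R') := by
          rw [h1, Matrix.mul_one]; simp only [Matrix.mul_assoc]
  have hWC : C₀ * T⁻¹ * (T * R') = G.C := by
    calc C₀ * T⁻¹ * (T * R') = C₀ * (T⁻¹ * T) * R' := by simp only [Matrix.mul_assoc]
      _ = G.C := by rw [hT1, Matrix.mul_one, ← hRC, Matrix.mul_assoc, h2, Matrix.mul_one]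
  have hphys : T * A₀ * T⁻¹ + QLin.flat (T * A₀ * T⁻¹) +
      QLin.flat (C₀ * T⁻¹) * (C₀ * T⁻¹) = 0 := by
    have hA : T * A₀ * T⁻¹ = T * R' * G.A * QLin.flat (T * R') := by
      rw [hWA, Matrix.mul_assoc _ (T * R'), hW.2.2, Matrix.mul_one]
    have hC : C₀ * T⁻¹ = G.C * QLin.flat (T * R') := by
      rw [← hWC, Matrix.mul_assoc _ (T * R'), hW.2.2, Matrix.mul_one]
    have := congrArg (fun Z => T * R' * Z * QLin.flat (T * R')) G.A_add_flat_A
    rw [hA, hC, flat_mul (T * R' * G.A), flat_mul (T * R') G.A, flat_mul G.C, flat_flat]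
    simpa only [Matrix.mul_add, Matrix.add_mul, Matrix.mul_assoc, Matrix.mul_zero,
      Matrix.zero_mul] using this
  set K := ofAC (T * A₀ * T⁻¹) (C₀ * T⁻¹) ((hTd.mul h.doubledUp_A).mul hTd.inv)
    (h.doubledUp_C.mul hTd.inv) hphys with hK
  have hequiv : G.SymplecticEquiv K :=
    symplecticEquiv_of_similarity hG.1 hW (by rw [hK, ofAC_A]; exact hWA)
      (by rw [hK, ofAC_C]; exact hWC)
  obtain ⟨hmin, hfreq⟩ := hG.of_symplecticEquiv hequiv
  exact ⟨K, rfl, rfl, hfreq, hmin⟩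

/-- The scattering matrix of a system preserves the input covariance if the spectrum agrees with one
of a system without scattering. -/
lemma S_mul_mul_of_powerSpectrum_eq {G : System m n} {K : System m k} (hS : G.S = 1)
    (h : K.powerSpectrum V = G.powerSpectrum V) : K.S * V * K.Sᴴ = V := by
  -- At high frequency the resolvent term vanishes, so the spectrum tends to `S V S†`.
  have key : ∀ {j : ℕ} (L : System m j), Tendsto (L.powerSpectrum V) atTop (𝓝 (L.S * V * L.Sᴴ)) := by
    intro j L
    have h1 := L.tendsto_transfer.comp tendsto_axis
    have hc : Continuous fun X : Matrix (Doubled m) (Doubled m) ℂ => X * V * Xᴴ :=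
      (continuous_id.matrix_mul continuous_const).matrix_mul continuous_id.matrix_conjTranspose
    refine ((hc.tendsto _).comp h1).congr fun ω => ?_
    have e : -(starRingEnd ℂ (-(Complex.I * ω))) = -(Complex.I * ω) := by simp
    rw [powerSpectrum, spectralDensity, e]
    rfl
  have h1 := key K
  rw [h] at h1
  have h2 := tendsto_nhds_unique h1 (key G)
  rwa [hS, Matrix.one_mul, Matrix.conjTranspose_one, Matrix.mul_one] at h2

/-- The system with its scattering matrix removed. -/
def unscattered (G : System m n) : System m n :=
  { G with S := 1, symplectic_S := isSymplectic_one }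

lemma unscattered_powerSpectrum {G : System m n} (h : G.S * V * G.Sᴴ = V) :
    G.unscattered.powerSpectrum V = G.powerSpectrum V := by
  ext1 ω
  have e : ∀ s, G.transfer s = G.unscattered.transfer s * G.S := by
    intro s
    have : G.unscattered.transfer s =
      (1 - G.C * (s • (1 : Matrix (Doubled n) (Doubled n) ℂ) - G.A)⁻¹ * QLin.flat G.C) * 1 := rfl
    rw [this, Matrix.mul_one, transfer]
  rw [powerSpectrum, powerSpectrum, spectralDensity, spectralDensity, e, e,
    Matrix.conjTranspose_mul]
  nth_rewrite 1 [← h]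
  simp only [Matrix.mul_assoc]

/-- Minimality competes against systems with arbitrary scattering. A minimiser has `S V S† = V`, so
replacing its `S` by `1` keeps both the spectrum and the number of modes. -/
theorem exists_isGloballyMinimalRealisation {G : System m n} (hS : G.S = 1) (hG : G.IsHurwitz) :
    ∃ (k : ℕ) (K : System m k), K.IsGloballyMinimalRealisation V (G.powerSpectrum V) := by
  classical
  let p : ℕ → Prop := fun k => ∃ K : System m k, K.IsHurwitz ∧
    K.powerSpectrum V = G.powerSpectrum V
  have hp : ∃ k, p k := ⟨n, G, hG, rfl⟩
  obtain ⟨K, hK, hKp⟩ := Nat.find_spec hp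
  have h1 := (unscattered_powerSpectrum (S_mul_mul_of_powerSpectrum_eq hS hKp)).trans hKp
  exact ⟨Nat.find hp, K.unscattered, rfl, h1, hK, fun j L hL hLp =>
    Nat.find_min' hp ⟨L, hL, hLp.trans h1⟩⟩

lemma bar_transfer (G : System m n) (s : ℂ) : bar (G.transfer s) = G.transfer (star s) := by
  rw [transfer, transfer, bar_mul, bar_sub, bar_mul, bar_mul, bar_inv, bar_sub, bar_smul, bar_flat,
    bar_one, bar_one, isDoubledUp_iff.1 G.doubledUp_C, isDoubledUp_iff.1 G.isDoubledUp_A,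
    isDoubledUp_iff.1 G.symplectic_S.1]

/-- The transfer function of a globally minimal realisation is determined by the power spectrum. -/
theorem IsGloballyMinimalRealisation.freqTransfer_eq {v : Doubled 1 → ℂ} (hv : br v v = 1)
    {Ψ : ℝ → Matrix (Doubled 1) (Doubled 1) ℂ} {G : System 1 k} {K : System 1 l}
    (hG : G.IsGloballyMinimalRealisation (Matrix.vecMulVec v (star v)) Ψ)
    (hK : K.IsGloballyMinimalRealisation (Matrix.vecMulVec v (star v)) Ψ) :
    G.freqTransfer = K.freqTransfer := by
  have h : ∀ s : ℂ, 0 ≤ s.re → G.transfer s *ᵥ v = K.transfer s *ᵥ v := fun s hs =>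
    transfer_mulVec_eq hv hG.1 hK.1 hG.2.2 hK.2.2 (hG.2.1.trans hK.2.1.symm) hs
  refine freqTransfer_eq_of_transfer fun s hs => eq_of_mulVec_eq hv (h s hs) ?_
  -- The doubled-up symmetry gives the value on the conjugate of `v` at `s` from the value on `v` at
  -- `s^#`, a point of the same closed half-plane.
  have h1 : ∀ {j : ℕ} (L : System 1 j),
      L.transfer s *ᵥ vconj v = vconj (L.transfer (star s) *ᵥ v) := by
    intro j L
    rw [vconj_mulVec, bar_transfer, star_star]
  rw [h1, h1, h (star s) (by simpa using hs)]

end System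

end Equivalence

end QLin

end

theorem mainTheorem5
    (N M : Matrix (Fin 1) (Fin 1) ℂ) (hV : QLin.IsPureInput N M) :
    ∃ factor : (ℝ → Matrix (QLin.Doubled 1) (QLin.Doubled 1) ℂ) →
        (ℝ → Matrix (QLin.Doubled 1) (QLin.Doubled 1) ℂ),
      ∀ (n : ℕ) (G : QLin.System 1 n), G.S = 1 → G.IsHurwitz →
        ∀ Ψ Ξ' : ℝ → Matrix (QLin.Doubled 1) (QLin.Doubled 1) ℂ,
          Ψ = G.powerSpectrum (QLin.inputCovariance N M) → Ξ' = factor Ψ →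
          -- `Ξ'` is the transfer function of a globally minimal realisation
          (∃ (n' : ℕ) (G' : QLin.System 1 n'),
            G'.IsGloballyMinimalRealisation (QLin.inputCovariance N M) Ψ ∧
              G'.freqTransfer = Ξ') ∧
          -- `Ξ'` has a minimal doubled-up classical realisation
          (∃ (k : ℕ) (A₀ : Matrix (QLin.Doubled k) (QLin.Doubled k) ℂ)
            (B₀ : Matrix (QLin.Doubled k) (QLin.Doubled 1) ℂ)
            (C₀ : Matrix (QLin.Doubled 1) (QLin.Doubled k) ℂ),
            QLin.IsMinimalClassicalRealisation A₀ B₀ C₀ Ξ') ∧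
          -- a globally minimal realisation is obtained from any such realisation of `Ξ'`
          (∀ (k : ℕ) (A₀ : Matrix (QLin.Doubled k) (QLin.Doubled k) ℂ)
            (B₀ : Matrix (QLin.Doubled k) (QLin.Doubled 1) ℂ)
            (C₀ : Matrix (QLin.Doubled 1) (QLin.Doubled k) ℂ),
            QLin.IsMinimalClassicalRealisation A₀ B₀ C₀ Ξ' →
              (∃ T, QLin.IsPhysicalTransformation A₀ C₀ T) ∧
              ∀ T, QLin.IsPhysicalTransformation A₀ C₀ T →
                ∃ G' : QLin.System 1 k,
                  G'.C = C₀ * T⁻¹ ∧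
                  G'.Ω = Complex.I • (QLin.J k *
                    (T * A₀ * T⁻¹ + (1 / 2 : ℂ) • (QLin.flat (C₀ * T⁻¹) * (C₀ * T⁻¹)))) ∧
                  G'.freqTransfer = Ξ' ∧
                  G'.IsGloballyMinimalRealisation (QLin.inputCovariance N M) Ψ) ∧
          -- uniqueness up to symplectic equivalence
          (∀ (k : ℕ) (G₁ : QLin.System 1 k),
            G₁.IsGloballyMinimalRealisation (QLin.inputCovariance N M) Ψ →
              G₁.freqTransfer = Ξ' ∧
              ∀ (l : ℕ) (G₂ : QLin.System 1 l),
                G₂.IsGloballyMinimalRealisation (QLin.inputCovariance N M) Ψ ↔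
                  G₁.SymplecticEquiv G₂) := by
  classical
  obtain ⟨v, hv, hVv⟩ := QLin.exists_vecMulVec_of_isPureInput hV
  rw [hVv]
  set V := Matrix.vecMulVec v (star v) with hVdef
  -- Any choice of globally minimal realisation serves, as all share one transfer function. The
  -- default `0` is never taken at the spectrum of a stable system with `S = 1`.
  refine ⟨fun Ψ => if h : ∃ (k : ℕ) (K : QLin.System 1 k), K.IsGloballyMinimalRealisation V Ψ then
    h.choose_spec.choose.freqTransfer else 0, ?_⟩
  rintro n G hS hG Ψ Ξ' hΨ hΞ
  have hex : ∃ (k : ℕ) (K : QLin.System 1 k), K.IsGloballyMinimalRealisation V Ψ := by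
    rw [hΨ]
    exact QLin.System.exists_isGloballyMinimalRealisation hS hG
  simp only [dif_pos hex] at hΞ
  have hK := hex.choose_spec.choose_spec
  set K := hex.choose_spec.choose
  subst hΞ
  refine ⟨⟨_, K, hK, rfl⟩, ⟨_, _, _, _, QLin.System.isMinimalClassicalRealisation hK.2.2 hK.1⟩,
    fun k A₀ B₀ C₀ h => QLin.System.exists_of_isPhysicalTransformation hK h, fun k G₁ hG₁ => ?_⟩
  refine ⟨hG₁.freqTransfer_eq hv hK, fun l G₂ => ⟨fun hG₂ => ?_, fun h => ?_⟩⟩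
  · exact QLin.System.symplecticEquiv_of_freqTransfer_eq hG₁ hG₂ (hG₁.freqTransfer_eq hv hG₂)
  · exact (hG₁.of_symplecticEquiv h).1
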